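/- **Setting.** Let $m\ge 1$, let $(\Delta,\mathfrak D,\mathbb P)$ be a probability space and $\mathcal Z$ a set of decisions. For $i=1,\dots,m$ and $\delta\in\Delta$ let $\mathcal Z_i(\delta)\subseteq\mathcal Z$ be the set of decisions that are appropriate for criterion $i$ under $\delta$. The individual risks of $z\in\mathcal Z$ are $V_i(z)=\mathbb P\{\delta: z\notin\mathcal Z_i(\delta)\}$, and $\boldsymbol V(z)=(V_1(z),\dots,V_m(z))$. A decision map $\mathcal M$ assigns a decision to every $m$-tuple $(\mathcal D_1,\dots,\mathcal D_m)$ of finite (possibly empty) lists of elements of $\Delta$. The usual measurability is assumed: for all sizes of the lists and all $i$, the event $\mathcal M(\mathcal D_1,\dots,\mathcal D_m)\in\mathcal Z_i(\delta)$ is jointly measurable in the data and $\delta$. *Assumption 1.* For all finite lists $\mathcal D_i$ and $\widetilde{\mathcal D}_i$ ($i=1,\dots,m$), with $\mathcal D_i^+$ the list $\mathcal D_i$ followed by $\widetilde{\mathcal D}_i$: (i) $\mathcal M(\mathcal D_1,\dots,\mathcal D_m)$ does not change when the elements of each $\mathcal D_i$ are permuted; (ii) if $\mathcal M(\mathcal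 D_1,\dots,\mathcal D_m)\in\mathcal Z_i(\delta)$ for all $i$ and all $\delta\in\widetilde{\mathcal D}_i$, then $\mathcal M(\mathcal D_1^+,\dots,\mathcal D_m^+)=\mathcal M(\mathcal D_1,\dots,\mathcal D_m)$; (iii) if $\mathcal M(\mathcal D_1,\dots,\mathcal D_m)\notin\mathcal Z_i(\delta)$ for some $i$ and some $\delta\in\widetilde{\mathcal D}_i$, then $\mathcal M(\mathcal D_1^+,\dots,\mathcal D_m^+)\ne\mathcal M(\mathcal D_1,\dots,\mathcal D_m)$. An entry of one of the lists $\mathcal D_i$ is a *support scenario* if removing it, while keeping all the others, changes the decision. The *complexity* is the vector $\boldsymbol s^\star$ whose component $s_i^\star$ is the number of support scenarios in $\mathcal D_i$. *Assumption 2 (non-degeneracy).* For every $\boldsymbol N\in\mathbb Z^m$ with all $N_i\ge1$, if $\mathcal D_1,\dots,\mathcal D_m$ consist of $N_1,\dots,N_m$ elements, all drawn independently from $\mathbb P$, then almost surely $\mathcal M(\mathcal S_1,\dots,\mathcal S_m)=\mathcal M(\mathcal D_1,\dots,\mathcal D_m)$, where $\mathcal S_i$ is the sub-list of the support scenarios in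 $\mathcal D_i$. **Notation.** Inequalities between vectors are componentwise; $\boldsymbol k<\boldsymbol N$ means $k_i<N_i$ for all $i$; $\boldsymbol 1=(1,\dots,1)$; $\binom{\boldsymbol h}{\boldsymbol k}=\prod_i\binom{h_i}{k_i}$ and $\boldsymbol u^{\boldsymbol h}=\prod_i u_i^{h_i}$. Fix integer vectors $\boldsymbol N$ with all $N_i\ge1$ and $\boldsymbol H\ge\boldsymbol N$, and $\beta\in(0,1)$. For an integer vector $\boldsymbol k$ with $\boldsymbol 0\le\boldsymbol k\le\boldsymbol N$ let $\mathcal J_{\boldsymbol k}=\{j\in\mathbb Z:\max_i(k_i-N_i)\le j\le\min_i(H_i-N_i)\}$, $\hat t=\prod_i(1-k_i/N_i)$ and $$\psi_{\boldsymbol k,\boldsymbol N,\boldsymbol H}(t)=1-\frac{\beta}{|\mathcal J_{\boldsymbol 0}|-1}\sum_{j\in\mathcal J_{\boldsymbol k}\setminus\{0\}}\frac{\binom{\boldsymbol N+j\boldsymbol 1}{\boldsymbol k}}{\binom{\boldsymbol N}{\boldsymbol k}}\,t^j .$$ Let $\bar t_{\boldsymbol k}$ be the unique zero of $\psi_{\boldsymbol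 k,\boldsymbol N,\boldsymbol H}$ in $(0,\hat t)$ if $\boldsymbol k<\boldsymbol N$, and $\bar t_{\boldsymbol k}=0$ otherwise; let $\underline t_{\boldsymbol k}$ be the unique zero of $\psi_{\boldsymbol k,\boldsymbol N,\boldsymbol H}$ in $(\hat t,\infty)$ if $\boldsymbol H>\boldsymbol N$, and $\underline t_{\boldsymbol k}=1$ otherwise. Let $$\mathcal R(\boldsymbol k)=\Big\{\boldsymbol v\in[0,1]^m:\ \prod_{i=1}^m(1-v_i)\in[\bar t_{\boldsymbol k},\underline t_{\boldsymbol k}]\Big\}.$$ The diagonal allocation is the family $(\lambda_{\boldsymbol h})_{\boldsymbol 0\le\boldsymbol h\le\boldsymbol H}$ with $\lambda_{\boldsymbol N}=1$, $\lambda_{\boldsymbol N+j\boldsymbol 1}=-\beta/(|\mathcal J_{\boldsymbol 0}|-1)$ for $j\in\mathcal J_{\boldsymbol 0}\setminus\{0\}$, and $\lambda_{\boldsymbol h}=0$ for all other $\boldsymbol h$. **Proposition.** Under Assumptions 1 and 2: 1. For every $\boldsymbol 0\le\boldsymbol k\le\boldsymbol N$ the zeros in the definition of $\bar t_{\boldsymbol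 k}$ (if $\boldsymbol k<\boldsymbol N$) and of $\underline t_{\boldsymbol k}$ (if $\boldsymbol H>\boldsymbol N$) exist and are unique. 2. $\mathcal R(\boldsymbol k)$ is the region generated by the diagonal allocation: for every $\boldsymbol 0\le\boldsymbol k\le\boldsymbol N$ and every $\boldsymbol v\in[0,1]^m$ with $(\boldsymbol 1-\boldsymbol v)^{\boldsymbol N-\boldsymbol k}>0$, $$\boldsymbol v\in\mathcal R(\boldsymbol k)\iff\sum_{\boldsymbol k\le\boldsymbol h\le\boldsymbol H}\lambda_{\boldsymbol h}\frac{\binom{\boldsymbol h}{\boldsymbol k}}{\binom{\boldsymbol N}{\boldsymbol k}}(\boldsymbol 1-\boldsymbol v)^{\boldsymbol h-\boldsymbol N}\ge0 ,$$ where terms with $\lambda_{\boldsymbol h}=0$ are taken to be $0$. 3. If $\mathcal D_1,\dots,\mathcal D_m$ consist of $N_1,\dots,N_m$ elements, all drawn independently from $\mathbb P$, then $z^\star_{\boldsymbol N}=\mathcal M(\mathcal D_1,\dots,\mathcal D_m)$, with complexity $\boldsymbol s^\star_{\boldsymbol N}$, satisfies $$\mathbb P^{|\boldsymbol N|}\{\boldsymbol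 V(z^\star_{\boldsymbol N})\in\mathcal R(\boldsymbol s^\star_{\boldsymbol N})\}\ge1-\beta,\qquad |\boldsymbol N|=N_1+\dots+N_m$$ (the event being measurable). -/

import Mathlib

open MeasureTheory

noncomputable section

namespace MultiScenario

/-! ## Data, decisions, risks -/

section Data

variable {m : ℕ} {Δ 𝒵 : Type*}

/-- A collection of `N i` scenarios for each criterion `i`, i.e. an element of `Δ ^ |N|`. -/
abbrev Sample (Δ : Type*) (N : Fin m → ℕ) : Type _ := ((i : Fin m) × Fin (N i)) → Δ

/-- The list of datasets: the `i`-th list holds the scenarios of criterion `i`. -/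
def datasets {N : Fin m → ℕ} (ω : Sample Δ N) : Fin m → List Δ :=
  fun i => List.ofFn fun j => ω ⟨i, j⟩

/-- The law of `|N|` independent draws from `P`. -/
def sampleLaw [MeasurableSpace Δ] (P : Measure Δ) (N : Fin m → ℕ) : Measure (Sample Δ N) :=
  Measure.pi fun _ => P

/-- The vector of individual risks `V_i(z) = P {δ : z ∉ 𝒵_i(δ)}`; here `A i δ` is the set `𝒵_i(δ)`
of the decisions that are appropriate for criterion `i` under `δ`. -/
def riskVec [MeasurableSpace Δ] (P : Measure Δ) (A : Fin m → Δ → Set 𝒵) (z : 𝒵) : Fin m → ℝ :=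
  fun i => P.real {δ | z ∉ A i δ}

/-- Permutation invariance and the two consistency conditions for a decision map. A decision map
is defined on all lists of datasets; some of the datasets may be empty. -/
structure IsConsistent (A : Fin m → Δ → Set 𝒵) (M : (Fin m → List Δ) → 𝒵) : Prop where
  permutation_invariance : ∀ D D' : Fin m → List Δ, (∀ i, (D' i).Perm (D i)) → M D' = M D
  stability : ∀ D E : Fin m → List Δ, (∀ i, ∀ δ ∈ E i, M D ∈ A i δ) →
    M (fun i => D i ++ E i) = M D
  responsiveness : ∀ D E : Fin m → List Δ, (∃ i, ∃ δ ∈ E i, M D ∉ A i δ) →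
    M (fun i => D i ++ E i) ≠ M D

/-- The scenario at position `j` of the `i`-th dataset (positions are counted from `0`) is a support scenario: its removal, all the other
scenarios being kept, changes the decision. -/
def IsSupport (M : (Fin m → List Δ) → 𝒵) (D : Fin m → List Δ) (i : Fin m)
    (j : ℕ) : Prop :=
  M (Function.update D i ((D i).eraseIdx j)) ≠ M D

open Classical in
/-- The sub-lists of the support scenarios, for all criteria. -/
def supportLists (M : (Fin m → List Δ) → 𝒵) (D : Fin m → List Δ) : Fin m → List Δ :=
  fun i => ((List.finRange (D i).length).filter fun j : Fin (D i).length =>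
    decide (IsSupport M D i j.val)).map (D i).get

/-- The complexity: the vector of the numbers of support scenarios. -/
def complexity (M : (Fin m → List Δ) → 𝒵) (D : Fin m → List Δ) : Fin m → ℕ :=
  fun i => (supportLists M D i).length

/-- Non-degeneracy: for any positive numbers of scenarios, almost surely the support scenarios alone give
the same decision as the whole of the data. -/
def NonDegenerate [MeasurableSpace Δ] (P : Measure Δ) (M : (Fin m → List Δ) → 𝒵) : Prop :=
  ∀ N : Fin m → ℕ, (∀ i, 0 < N i) → ∀ᵐ ω ∂(sampleLaw P N),
    M (supportLists M (datasets ω)) = M (datasets ω)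

/-- The events `M(𝒟) ∈ 𝒵_i(δ)` that involve data and one further `δ` are measurable. -/
def MeasurableAppropriateness [MeasurableSpace Δ] (A : Fin m → Δ → Set 𝒵)
    (M : (Fin m → List Δ) → 𝒵) : Prop :=
  ∀ (N : Fin m → ℕ) (i : Fin m),
    MeasurableSet {p : Sample Δ N × Δ | M (datasets p.1) ∈ A i p.2}

end Data

/-! ## Diagonal allocation and the region -/

section Region

variable {m : ℕ}

/-- The product of binomial coefficients over the components of two multi-indices. -/
def multiChoose (h k : Fin m → ℕ) : ℕ := ∏ i, (h i).choose (k i)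

variable [NeZero m]

/-- `𝒥_k = {max (k - N), …, min (H - N)}`, a set of integers. -/
def diagRange (k N H : Fin m → ℕ) : Finset ℤ :=
  Finset.Icc (Finset.univ.sup' Finset.univ_nonempty fun i => (k i : ℤ) - N i)
    (Finset.univ.inf' Finset.univ_nonempty fun i => (H i : ℤ) - N i)

open Classical in
/-- The diagonal allocation of the variables `λ_h`. -/
def diagAllocation (β : ℝ) (N H h : Fin m → ℕ) : ℝ :=
  if h = N then 1
  else if ∃ j ∈ diagRange 0 N H \ {0}, ∀ i, (h i : ℤ) = N i + j then
    -β / ((diagRange 0 N H).card - 1)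
  else 0

/-- `∑_{h = k}^{H} λ_h (h choose k) / (N choose k) (1 - v) ^ (h - N)`. -/
def dualSum (lam : (Fin m → ℕ) → ℝ) (k N H : Fin m → ℕ) (v : Fin m → ℝ) : ℝ :=
  ∑ h ∈ Finset.Icc k H, lam h * ((multiChoose h k : ℝ) / multiChoose N k) *
    ∏ i, (1 - v i) ^ ((h i : ℤ) - N i)

/-- The function `ψ_{k,N,H}`. For `j ∈ 𝒥_k` the components of `N + j 1` are non-negative, so that
`Int.toNat` does not truncate. -/
def psi (β : ℝ) (k N H : Fin m → ℕ) (t : ℝ) : ℝ :=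
  1 - β / ((diagRange 0 N H).card - 1) *
    ∑ j ∈ diagRange k N H \ {0},
      ((multiChoose (fun i => ((N i : ℤ) + j).toNat) k : ℝ) / multiChoose N k) * t ^ j

/-- `t̂ = ∏ (1 - k_i / N_i)`. -/
def tHat (k N : Fin m → ℕ) : ℝ := ∏ i, (1 - (k i : ℝ) / N i)

open Classical in
/-- The zero of `ψ_{k,N,H}` in `(0, t̂)` if `k_i < N_i` for all `i`, and `0` otherwise. -/
def tLeft (β : ℝ) (k N H : Fin m → ℕ) : ℝ :=
  if ∀ i, k i < N i then
    Classical.epsilon fun t => t ∈ Set.Ioo 0 (tHat k N) ∧ psi β k N H t = 0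
  else 0

open Classical in
/-- The zero of `ψ_{k,N,H}` in `(t̂, ∞)` if `N_i < H_i` for all `i`, and `1` otherwise. -/
def tRight (β : ℝ) (k N H : Fin m → ℕ) : ℝ :=
  if ∀ i, N i < H i then
    Classical.epsilon fun t => t ∈ Set.Ioi (tHat k N) ∧ psi β k N H t = 0
  else 1

/-- The region `ℛ(k)`. -/
def region (β : ℝ) (N H k : Fin m → ℕ) : Set (Fin m → ℝ) :=
  {v | (∀ i, v i ∈ Set.Icc (0 : ℝ) 1) ∧
    ∏ i, (1 - v i) ∈ Set.Icc (tLeft β k N H) (tRight β k N H)}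

end Region

end MultiScenario

end

open MultiScenario

namespace MultiScenario

/-! ## The functions `ψ` and the region -/

/-! Call a set of positions irreducible if each of its scenarios is a support scenario of the data
restricted to it. By consistency, an irreducible set of size `k` among `h` scenarios yields the
decision of the whole data exactly when its own decision is appropriate for all other positions. By
independence the probability of this is the integral of `∏ (1 - V_i) ^ (h_i - k_i)` over the
irreducible samples of size `k` (`measureReal_determines`): `h` enters only through the exponents.
Non-degeneracy makes the determining set almost surely unique, namely the support
(`determines_iff`). Hence these probabilities, counted with multiplicity `multiChoose h k`, sum over
`k ≤ N` to at most 1, and to exactly 1 for `h = N`; since `h` may have zero components, risks are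
first restricted to `positiveSet N k`.

The confidence bound is weak duality (`sum_le_measureReal_event`). Weight these relations by `λ_h`,
which is nonpositive for `h ≠ N`, and exchange the sums. For each `k` the integrand becomes
`multiChoose N k * (1 - V) ^ (N - k)` times the dual sum; the latter is at most 1, and at most 0
outside the region, so the total is at most the probability of the region. For the diagonal
allocation `∑ λ_h = 1 - β`.

On the diagonal the dual sum is `ψ` evaluated at `∏ (1 - v_i)` (`dualSum_diagAllocation`). Now `ψ`
is concave, and `ψ(t̂) > 0` because `n ↦ (n choose k) (1 - k/N) ^ n` is largest at `n = N`. So `ψ ≥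
0` describes an interval around `t̂`, and its ends are the zeros in question
(`mem_Icc_tLeft_tRight_iff`). -/

/-- One factor of a coefficient of `ψ` at `t̂` is at most one. -/
theorem choose_mul_zpow_le {N k : ℕ} (hN : 0 < N) (hk : k ≤ N) {n : ℕ} (hn : k ≤ n) :
    (n.choose k : ℝ) * (1 - (k : ℝ) / N) ^ ((n : ℤ) - N) ≤ N.choose k := by
  have hN' : (0 : ℝ) < N := by exact_mod_cast hN
  have hq0 : (0 : ℝ) ≤ 1 - (k : ℝ) / N := by
    rw [sub_nonneg, div_le_one hN']; exact_mod_cast hk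
  rcases le_total N n with h | h
  -- Passing from `n ≥ N` to `n + 1` multiplies the left side by `(1 - k/N) / (1 - k/(n+1)) ≤ 1`.
  · induction n, h using Nat.le_induction with
    | base => simp
    | succ n h ih =>
      have hkn : k ≤ n := hk.trans h
      have ih := ih hkn
      refine le_trans ?_ ih
      have e1 : ((n + 1 : ℕ) : ℤ) - N = ((n - N : ℕ) : ℤ) + 1 := by omega
      have e2 : (n : ℤ) - N = ((n - N : ℕ) : ℤ) := by omega
      rw [e1, e2, zpow_natCast, ← Nat.cast_succ, zpow_natCast, pow_succ, mul_comm (_ ^ _), ← mul_assoc]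
      refine mul_le_mul_of_nonneg_right ?_ (pow_nonneg hq0 _)
      have key := Nat.choose_mul_succ_eq n k
      have key' : (n.choose k : ℝ) * (n + 1) = (n + 1).choose k * ((n : ℝ) + 1 - k) := by
        have : ((n + 1 - k : ℕ) : ℝ) = (n : ℝ) + 1 - k := by
          rw [Nat.cast_sub (by omega)]; push_cast; ring
        rw [← this]; exact_mod_cast key
      have hn1 : (0 : ℝ) < (n : ℝ) + 1 := by positivity
      have : (n.choose k : ℝ) = (n + 1).choose k * (1 - k / (n + 1)) := by
        field_simp; linarith
      rw [this]
      refine mul_le_mul_of_nonneg_left ?_ (by positivity)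
      have : (k : ℝ) / (n + 1) ≤ k / N := by
        gcongr
        have : (N : ℝ) ≤ n := by exact_mod_cast h
        linarith
      linarith
  · rcases hk.eq_or_lt with rfl | hk'
    · have : n = k := le_antisymm h hn
      subst this; simp
    have hq : (0 : ℝ) < 1 - (k : ℝ) / N := by
      rw [sub_pos, div_lt_one hN']; exact_mod_cast hk'
    obtain ⟨l, rfl⟩ : ∃ l, N = n + l := ⟨N - n, by omega⟩
    -- The base keeps `N = n + l` fixed while the induction climbs from `n` towards `N`; below `N`
    -- the ratio above is at least 1.
    have aux : ∀ l' ≤ l, (n.choose k : ℝ) ≤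
        (n + l').choose k * (1 - (k : ℝ) / (n + l : ℕ)) ^ l' := by
      intro l' hl'
      induction l' with
      | zero => simp
      | succ r ih =>
        refine (ih (by omega)).trans ?_
        have key := Nat.choose_mul_succ_eq (n + r) k
        have key' : ((n + r).choose k : ℝ) * (n + r + 1)
            = (n + r + 1).choose k * ((n : ℝ) + r + 1 - k) := by
          have : ((n + r + 1 - k : ℕ) : ℝ) = (n : ℝ) + r + 1 - k := by
            rw [Nat.cast_sub (by omega)]; push_cast; ring
          rw [← this]; exact_mod_cast key
        have hn1 : (0 : ℝ) < (n : ℝ) + r + 1 := by positivity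
        have e : ((n + r).choose k : ℝ) = (n + r + 1).choose k * (1 - k / (n + r + 1)) := by
          field_simp; linarith
        rw [e, pow_succ, mul_comm (_ ^ r), ← mul_assoc, ← add_assoc]
        refine mul_le_mul_of_nonneg_right (mul_le_mul_of_nonneg_left ?_ (by positivity))
          (pow_nonneg hq0 _)
        have : (k : ℝ) / (n + l : ℕ) ≤ k / (n + r + 1) := by
          gcongr
          have : ((n + r + 1 : ℕ) : ℝ) ≤ (n + l : ℕ) := by exact_mod_cast (by omega)
          push_cast at this ⊢; linarith
        linarith
    have e1 : (n : ℤ) - (n + l : ℕ) = -(l : ℤ) := by push_cast; ring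
    rw [e1, zpow_neg, zpow_natCast, ← div_eq_mul_inv, div_le_iff₀ (pow_pos hq _)]
    exact aux l le_rfl

/-! ### Sign of a concave function on either side of a root -/

section Concave

variable {f : ℝ → ℝ} {S : Set ℝ} {a b x : ℝ}

theorem _root_.ConcaveOn.pos_of_mem_segment (hf : ConcaveOn ℝ S f) (ha : a ∈ S) (hb : b ∈ S)
    (hfa : 0 < f a) (hfb : 0 ≤ f b) (hx : x ∈ segment ℝ a b) (hxb : x ≠ b) : 0 < f x := by
  obtain ⟨s, r, hs, hr, hsr, rfl⟩ := hx
  have h := hf.2 ha hb hs hr hsr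
  have hs' : 0 < s := by
    rcases hs.eq_or_lt with rfl | h'
    · exfalso; apply hxb
      have : r = 1 := by linarith
      simp [this]
    · exact h'
  refine lt_of_lt_of_le ?_ h
  simp only [smul_eq_mul]
  have := mul_pos hs' hfa
  have := mul_nonneg hr hfb
  linarith

/-- If `f x ≥ 0` for some `x > b`, then `b` would lie strictly before the end of the segment from
`a` to `x`, forcing `f b > 0`. -/
theorem _root_.ConcaveOn.nonneg_iff_le_of_root (hf : ConcaveOn ℝ S f) (ha : a ∈ S) (hfa : 0 < f a)
    (hb : b ∈ S) (hab : a < b) (hfb : f b = 0) (hx : x ∈ S) (hax : a ≤ x) :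
    0 ≤ f x ↔ x ≤ b := by
  constructor
  · intro h
    by_contra! hbx
    have := hf.pos_of_mem_segment ha hx hfa h
      (by rw [segment_eq_Icc hax]; exact ⟨hab.le, hbx.le⟩) hbx.ne
    linarith
  · intro h
    rcases h.eq_or_lt with rfl | h
    · exact hfb.ge
    · exact (hf.pos_of_mem_segment ha hb hfa hfb.ge
        (by rw [segment_eq_Icc hab.le]; exact ⟨hax, h.le⟩) h.ne).le

theorem _root_.ConcaveOn.nonneg_iff_ge_of_root (hf : ConcaveOn ℝ S f) (ha : a ∈ S) (hfa : 0 < f a)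
    (hb : b ∈ S) (hba : b < a) (hfb : f b = 0) (hx : x ∈ S) (hxa : x ≤ a) :
    0 ≤ f x ↔ b ≤ x := by
  constructor
  · intro h
    by_contra! hbx
    have := hf.pos_of_mem_segment ha hx hfa h
      (by rw [segment_symm, segment_eq_Icc hxa]; exact ⟨hbx.le, hba.le⟩) hbx.ne'
    linarith
  · intro h
    rcases h.eq_or_lt with rfl | h
    · exact hfb.ge
    · exact (hf.pos_of_mem_segment ha hb hfa hfb.ge
        (by rw [segment_symm, segment_eq_Icc hba.le]; exact ⟨h.le, hxa⟩) h.ne').le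

end Concave

/-! ### Zeros of `ψ` and their relation to the diagonal allocation -/

section Psi

variable {m : ℕ} [NeZero m] {k N H : Fin m → ℕ} {β : ℝ}

theorem mem_diagRange {j : ℤ} :
    j ∈ diagRange k N H ↔ (∀ i, (k i : ℤ) ≤ N i + j) ∧ ∀ i, (N i : ℤ) + j ≤ H i := by
  simp only [diagRange, Finset.mem_Icc, Finset.sup'_le_iff, Finset.le_inf'_iff, Finset.mem_univ,
    true_implies]
  constructor
  · rintro ⟨h1, h2⟩
    exact ⟨fun i => by have := h1 i; omega, fun i => by have := h2 i; omega⟩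
  · rintro ⟨h1, h2⟩
    exact ⟨fun i => by have := h1 i; omega, fun i => by have := h2 i; omega⟩

theorem zero_mem_diagRange (hk : k ≤ N) (hNH : N ≤ H) : (0 : ℤ) ∈ diagRange k N H := by
  rw [mem_diagRange]
  exact ⟨fun i => by have := hk i; simpa using this, fun i => by have := hNH i; simpa using this⟩

theorem diagRange_subset : diagRange k N H ⊆ diagRange 0 N H := by
  intro j
  simp only [mem_diagRange]
  exact fun h => ⟨fun i => by have := h.1 i; simp; omega, h.2⟩

/-- Because all `N_i ≥ 1`, both `0` and `-1` belong to `𝒥_0`; this keeps the denominator in `ψ`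
positive. -/
theorem one_lt_card_diagRange (hN : ∀ i, 0 < N i) (hNH : N ≤ H) :
    (1 : ℝ) < (diagRange 0 N H).card := by
  have h : 1 < (diagRange 0 N H).card := by
    rw [Finset.one_lt_card]
    refine ⟨0, zero_mem_diagRange (fun i => Nat.zero_le _) hNH, -1, ?_, by norm_num⟩
    rw [mem_diagRange]
    refine ⟨fun i => ?_, fun i => ?_⟩
    · have := hN i; simp; omega
    · have : N i ≤ H i := hNH i; omega
  exact_mod_cast h

/-- The coefficients of `1 - ψ`. -/
noncomputable def psiCoeff (β : ℝ) (k N H : Fin m → ℕ) (j : ℤ) : ℝ :=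
  β / ((diagRange 0 N H).card - 1) *
    ((multiChoose (fun i => ((N i : ℤ) + j).toNat) k : ℝ) / multiChoose N k)

theorem psi_eq (t : ℝ) :
    psi β k N H t = 1 - ∑ j ∈ diagRange k N H \ {0}, psiCoeff β k N H j * t ^ j := by
  simp only [psi, psiCoeff, Finset.mul_sum, mul_assoc]

omit [NeZero m] in
theorem multiChoose_pos {h k : Fin m → ℕ} (hk : k ≤ h) : 0 < multiChoose h k :=
  Finset.prod_pos fun i _ => Nat.choose_pos (hk i)

variable (hN : ∀ i, 0 < N i) (hNH : N ≤ H) (hβ : β ∈ Set.Ioo (0 : ℝ) 1) (hk : k ≤ N)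
include hN hNH hβ hk

theorem psiCoeff_pos {j : ℤ} (hj : j ∈ diagRange k N H) : 0 < psiCoeff β k N H j := by
  have h1 := one_lt_card_diagRange hN hNH
  have h2 : 0 < multiChoose (fun i => ((N i : ℤ) + j).toNat) k :=
    multiChoose_pos fun i => by
    have : (k i : ℤ) ≤ N i + j := (mem_diagRange.1 hj).1 i
    show k i ≤ ((N i : ℤ) + j).toNat; omega
  have h3 := multiChoose_pos hk
  have := hβ.1
  have : (0 : ℝ) < (diagRange 0 N H).card - 1 := by linarith
  unfold psiCoeff
  positivity

omit [NeZero m] hN hNH hβ in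
theorem tHat_nonneg : 0 ≤ tHat k N := by
  refine Finset.prod_nonneg fun i _ => ?_
  have : (k i : ℝ) ≤ N i := by exact_mod_cast hk i
  rw [sub_nonneg]
  exact div_le_one_of_le₀ this (by positivity)

omit [NeZero m] hN hNH hβ in
theorem tHat_le_one : tHat k N ≤ 1 := by
  refine Finset.prod_le_one (fun i _ => ?_) fun i _ => ?_
  · have : (k i : ℝ) ≤ N i := by exact_mod_cast hk i
    rw [sub_nonneg]
    exact div_le_one_of_le₀ this (by positivity)
  · have : (0 : ℝ) ≤ k i / N i := by positivity
    linarith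

omit [NeZero m] hN hNH hβ hk in
theorem tHat_pos (hkN : ∀ i, k i < N i) : 0 < tHat k N := by
  refine Finset.prod_pos fun i _ => ?_
  have : (k i : ℝ) < N i := by exact_mod_cast hkN i
  rw [sub_pos, div_lt_one (by linarith [Nat.cast_nonneg (α := ℝ) (k i)])]
  exact this

omit [NeZero m] hNH hβ in
theorem tHat_eq_zero (hkN : ¬ ∀ i, k i < N i) : tHat k N = 0 := by
  push Not at hkN
  obtain ⟨i, hi⟩ := hkN
  refine Finset.prod_eq_zero (Finset.mem_univ i) ?_
  have hi : k i = N i := le_antisymm (hk i) hi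
  have : (N i : ℝ) ≠ 0 := by exact_mod_cast (hN i).ne'
  rw [hi, div_self this, sub_self]

omit hNH hβ in
-- Both the coefficient and `t̂ ^ j` factor over the criteria, and each factor is controlled by
-- `choose_mul_zpow_le`.
theorem coeff_mul_tHat_le {j : ℤ} (hj : j ∈ diagRange k N H) :
    ((multiChoose (fun i => ((N i : ℤ) + j).toNat) k : ℝ) / multiChoose N k) * tHat k N ^ j ≤ 1 := by
  have h3 : (0 : ℝ) < multiChoose N k := by exact_mod_cast multiChoose_pos hk
  rw [div_mul_eq_mul_div, div_le_one h3]
  simp only [multiChoose, tHat, ← Finset.prod_zpow, Nat.cast_prod]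
  rw [← Finset.prod_mul_distrib]
  refine Finset.prod_le_prod (fun i _ => ?_) fun i _ => ?_
  · have : (k i : ℝ) ≤ N i := by exact_mod_cast hk i
    have : (0 : ℝ) ≤ 1 - k i / N i := by
      rw [sub_nonneg]
      exact div_le_one_of_le₀ this (by positivity)
    positivity
  · have h1 := (mem_diagRange.1 hj).1 i
    have := choose_mul_zpow_le (hN i) (hk i) (n := ((N i : ℤ) + j).toNat) (by omega)
    have e : ((((N i : ℤ) + j).toNat : ℕ) : ℤ) - N i = j := by omega
    rwa [e] at this

/-- The sum has `|𝒥_k| - 1 ≤ |𝒥_0| - 1` terms, each at most 1 at `t̂`, so `ψ(t̂) ≥ 1 - β`. -/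
theorem psi_tHat_pos : 0 < psi β k N H (tHat k N) := by
  have h1 := one_lt_card_diagRange hN hNH
  have h0 : (0 : ℝ) < (diagRange 0 N H).card - 1 := by linarith
  have hle : ∑ j ∈ diagRange k N H \ {0},
      ((multiChoose (fun i => ((N i : ℤ) + j).toNat) k : ℝ) / multiChoose N k) * tHat k N ^ j
      ≤ (diagRange 0 N H).card - 1 := by
    calc _ ≤ ∑ j ∈ diagRange k N H \ {0}, (1 : ℝ) :=
          Finset.sum_le_sum fun j hj => coeff_mul_tHat_le hN hk (Finset.mem_sdiff.1 hj).1
      _ = ((diagRange k N H \ {0}).card : ℝ) := by simp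
      _ = (diagRange k N H).card - 1 := by
          rw [Finset.sdiff_singleton_eq_erase,
            Finset.cast_card_erase_of_mem (zero_mem_diagRange hk hNH)]
      _ ≤ _ := by
          have := Finset.card_le_card (diagRange_subset (k := k) (N := N) (H := H))
          have : ((diagRange k N H).card : ℝ) ≤ (diagRange 0 N H).card := by exact_mod_cast this
          linarith
  have : β / ((diagRange 0 N H).card - 1) * ∑ j ∈ diagRange k N H \ {0},
      ((multiChoose (fun i => ((N i : ℤ) + j).toNat) k : ℝ) / multiChoose N k) * tHat k N ^ j ≤ β := by
    calc _ ≤ β / ((diagRange 0 N H).card - 1) * ((diagRange 0 N H).card - 1) :=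
          mul_le_mul_of_nonneg_left hle (div_nonneg hβ.1.le h0.le)
      _ = β := by field_simp
  unfold psi
  linarith [hβ.2]

omit hN hNH hβ hk in
theorem concaveOn_one_sub_sum {S : Set ℝ} (hS : Convex ℝ S) (J : Finset ℤ) (c : ℤ → ℝ)
    (hc : ∀ j ∈ J, 0 ≤ c j) (hconv : ∀ j ∈ J, ConvexOn ℝ S fun t : ℝ => t ^ j) :
    ConcaveOn ℝ S fun t => 1 - ∑ j ∈ J, c j * t ^ j := by
  have : ConvexOn ℝ S fun t => ∑ j ∈ J, c j * t ^ j := by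
    induction J using Finset.cons_induction with
    | empty => simpa using convexOn_const (𝕜 := ℝ) (0 : ℝ) hS
    | cons a J ha ih =>
      simp only [Finset.sum_cons]
      refine ConvexOn.add ?_ (ih (fun j hj => hc j (by simp [hj])) fun j hj => hconv j (by simp [hj]))
      exact (hconv a (by simp)).smul (hc a (by simp))
  exact (concaveOn_const (𝕜 := ℝ) (1 : ℝ) hS).sub this

/-- On `(0, ∞)`, or on `[0, ∞)` when no negative exponent occurs, `ψ` is concave and continuous. -/
theorem psi_concave_continuous : ∃ S : Set ℝ, tHat k N ∈ S ∧ Set.Ioi 0 ⊆ S ∧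
    ((∀ i, k i < N i) → S = Set.Ioi 0) ∧ ((¬ ∀ i, k i < N i) → S = Set.Ici 0) ∧
    ConcaveOn ℝ S (psi β k N H) ∧ ContinuousOn (psi β k N H) S := by
  have hpsi : psi β k N H =
      fun t => 1 - ∑ j ∈ diagRange k N H \ {0}, psiCoeff β k N H j * t ^ j := funext psi_eq
  have hc : ∀ j ∈ diagRange k N H \ {0}, 0 ≤ psiCoeff β k N H j := fun j hj =>
    (psiCoeff_pos hN hNH hβ hk (Finset.mem_sdiff.1 hj).1).le
  by_cases hkN : ∀ i, k i < N i
  · refine ⟨Set.Ioi 0, tHat_pos hkN, subset_rfl, fun _ => rfl, fun h => absurd hkN h, ?_, ?_⟩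
    · rw [hpsi]
      exact concaveOn_one_sub_sum (convex_Ioi 0) _ _ hc fun j _ => convexOn_zpow j
    · rw [hpsi]
      refine continuousOn_const.sub (continuousOn_finsetSum _ fun j _ => continuousOn_const.mul ?_)
      exact fun x hx => (continuousAt_zpow₀ x j (Or.inl (ne_of_gt hx))).continuousWithinAt
  -- A component with `k_i = N_i` rules out negative `j`, so `ψ` is a polynomial and the point `0 =
  -- t̂` can be included in the domain.
  · have hj0 : ∀ j ∈ diagRange k N H \ {0}, 0 ≤ j := by
      push Not at hkN
      obtain ⟨i, hi⟩ := hkN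
      intro j hj
      have := (mem_diagRange.1 (Finset.mem_sdiff.1 hj).1).1 i
      have : k i ≤ N i := hk i
      omega
    refine ⟨Set.Ici 0, tHat_nonneg hk, Set.Ioi_subset_Ici_self, fun h => absurd h hkN,
      fun _ => rfl, ?_, ?_⟩
    · rw [hpsi]
      refine concaveOn_one_sub_sum (convex_Ici 0) _ _ hc fun j hj => ?_
      obtain ⟨n, rfl⟩ := Int.eq_ofNat_of_zero_le (hj0 j hj)
      simpa using convexOn_pow (𝕜 := ℝ) n
    · rw [hpsi]
      refine continuousOn_const.sub (continuousOn_finsetSum _ fun j hj => continuousOn_const.mul ?_)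
      exact fun x hx => (continuousAt_zpow₀ x j (Or.inr (hj0 j hj))).continuousWithinAt

/-- A single term already drives `ψ` below zero: `j = -1` near 0 and `j = 1` near infinity. -/
theorem psi_le {j : ℤ} (hj : j ∈ diagRange k N H) (hj0 : j ≠ 0) {t : ℝ} (ht : 0 ≤ t) :
    psi β k N H t ≤ 1 - psiCoeff β k N H j * t ^ j := by
  rw [psi_eq]
  have : psiCoeff β k N H j * t ^ j ≤
      ∑ j ∈ diagRange k N H \ {0}, psiCoeff β k N H j * t ^ j :=
    Finset.single_le_sum (f := fun j => psiCoeff β k N H j * t ^ j)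
      (fun j hj => mul_nonneg (psiCoeff_pos hN hNH hβ hk (Finset.mem_sdiff.1 hj).1).le
        (zpow_nonneg ht _)) (by simp [hj, hj0])
  linarith

theorem existsUnique_left (hkN : ∀ i, k i < N i) :
    ∃! t, t ∈ Set.Ioo 0 (tHat k N) ∧ psi β k N H t = 0 := by
  obtain ⟨S, ht, -, hS, -, hconc, hcont⟩ := psi_concave_continuous hN hNH hβ hk
  have hS := hS hkN
  subst hS
  have hpos := psi_tHat_pos hN hNH hβ hk
  have hj : (-1 : ℤ) ∈ diagRange k N H := by
    rw [mem_diagRange]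
    exact ⟨fun i => by have := hkN i; omega, fun i => by have : N i ≤ H i := hNH i; omega⟩
  have hc := psiCoeff_pos hN hNH hβ hk hj
  set c := psiCoeff β k N H (-1)
  have ht0 : 0 < tHat k N := ht
  -- The factor 1/2 gives both `x < t̂` and `c / x > 1`, hence `ψ(x) < 0`.
  set x := min (tHat k N) c / 2 with hx
  have hx0 : 0 < x := half_pos (lt_min ht0 hc)
  have hxt : x < tHat k N := by
    have := min_le_left (tHat k N) c
    have : x ≤ tHat k N / 2 := by rw [hx]; linarith
    linarith
  have hfx : psi β k N H x < 0 := by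
    have h := psi_le hN hNH hβ hk hj (by norm_num) hx0.le
    have : 1 < c * x ^ (-1 : ℤ) := by
      rw [zpow_neg_one, ← div_eq_mul_inv, one_lt_div hx0]
      have := min_le_right (tHat k N) c
      have : x ≤ c / 2 := by rw [hx]; linarith
      linarith
    linarith
  obtain ⟨r, hr, hr0⟩ := intermediate_value_Ioo hxt.le
    (hcont.mono fun y hy => lt_of_lt_of_le hx0 hy.1) (show (0 : ℝ) ∈ Set.Ioo _ _ from ⟨hfx, hpos⟩)
  refine ⟨r, ⟨⟨hx0.trans hr.1, hr.2⟩, hr0⟩, ?_⟩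
  rintro s ⟨hs, hs0⟩
  have hrS : (r : ℝ) ∈ Set.Ioi (0 : ℝ) := hx0.trans hr.1
  -- Each root is the left end of `{ψ ≥ 0}` below `t̂`, so each is at most the other.
  refine le_antisymm ?_ ?_
  · exact (hconc.nonneg_iff_ge_of_root ht hpos hs.1 hs.2 hs0 hrS hr.2.le).1 hr0.ge
  · exact (hconc.nonneg_iff_ge_of_root ht hpos hrS hr.2 hr0 hs.1 hs.2.le).1 hs0.ge

theorem existsUnique_right (hNH' : ∀ i, N i < H i) :
    ∃! t, t ∈ Set.Ioi (tHat k N) ∧ psi β k N H t = 0 := by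
  obtain ⟨S, ht, hIoi, -, -, hconc, hcont⟩ := psi_concave_continuous hN hNH hβ hk
  have hpos := psi_tHat_pos hN hNH hβ hk
  have ht0 := tHat_nonneg hk
  have hj : (1 : ℤ) ∈ diagRange k N H := by
    rw [mem_diagRange]
    exact ⟨fun i => by have : k i ≤ N i := hk i; omega, fun i => by have := hNH' i; omega⟩
  have hc := psiCoeff_pos hN hNH hβ hk hj
  set c := psiCoeff β k N H 1
  -- Beyond `c⁻¹` the term with `j = 1` alone exceeds 1.
  set x := max (tHat k N) c⁻¹ + 1 with hx
  have hxt : tHat k N < x := by have := le_max_left (tHat k N) c⁻¹; linarith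
  have hx0 : 0 < x := ht0.trans_lt hxt
  have hfx : psi β k N H x < 0 := by
    have h := psi_le hN hNH hβ hk hj (by norm_num) hx0.le
    have : 1 < c * x ^ (1 : ℤ) := by
      have h1 : c⁻¹ < x := by have := le_max_right (tHat k N) c⁻¹; linarith
      rw [zpow_one, ← mul_inv_cancel₀ hc.ne']
      exact mul_lt_mul_of_pos_left h1 hc
    linarith
  have hsub : Set.Icc (tHat k N) x ⊆ S := hconc.1.ordConnected.out ht (hIoi hx0)
  obtain ⟨r, hr, hr0⟩ := intermediate_value_Ioo' hxt.le
    (hcont.mono hsub) (show (0 : ℝ) ∈ Set.Ioo _ _ from ⟨hfx, hpos⟩)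
  refine ⟨r, ⟨hr.1, hr0⟩, ?_⟩
  rintro s ⟨hs, hs0⟩
  have hrS : r ∈ S := hIoi (ht0.trans_lt hr.1)
  have hsS : s ∈ S := hIoi (ht0.trans_lt hs)
  refine le_antisymm ?_ ?_
  · exact (hconc.nonneg_iff_le_of_root ht hpos hrS hr.1 hr0 hsS (le_of_lt hs)).1 hs0.ge
  · exact (hconc.nonneg_iff_le_of_root ht hpos hsS hs hs0 hrS hr.1.le).1 hr0.ge

/-- The two sides of `t̂` are treated separately, each by concavity and its root. The hypothesis `t
≤ 1` serves the default `tRight = 1`; `htk` avoids `t = 0`, where negative powers take the value 0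
by convention. -/
theorem mem_Icc_tLeft_tRight_iff {t : ℝ} (ht0 : 0 ≤ t) (ht1 : t ≤ 1)
    (htk : (∀ i, k i < N i) → 0 < t) :
    t ∈ Set.Icc (tLeft β k N H) (tRight β k N H) ↔ 0 ≤ psi β k N H t := by
  obtain ⟨S, ht, hIoi, hS, hS', hconc, -⟩ := psi_concave_continuous hN hNH hβ hk
  have hpos := psi_tHat_pos hN hNH hβ hk
  have htS : t ∈ S := by
    by_cases hkN : ∀ i, k i < N i
    · exact hIoi (htk hkN)
    · rw [hS' hkN]; exact ht0
  have hL : tLeft β k N H ≤ tHat k N ∧ (t < tHat k N → (0 ≤ psi β k N H t ↔ tLeft β k N H ≤ t)) := by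
    by_cases hkN : ∀ i, k i < N i
    · have h := Classical.epsilon_spec (existsUnique_left hN hNH hβ hk hkN).exists
      rw [tLeft, if_pos hkN]
      refine ⟨h.1.2.le, fun hlt => ?_⟩
      exact hconc.nonneg_iff_ge_of_root ht hpos (hIoi h.1.1) h.1.2 h.2 htS hlt.le
    · rw [tHat_eq_zero hN hk hkN, tLeft, if_neg hkN]
      exact ⟨le_rfl, fun h => absurd h ht0.not_gt⟩
  have hR : tHat k N ≤ tRight β k N H ∧
      (tHat k N ≤ t → (0 ≤ psi β k N H t ↔ t ≤ tRight β k N H)) := by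
    by_cases hNH' : ∀ i, N i < H i
    · have h := Classical.epsilon_spec (existsUnique_right hN hNH hβ hk hNH').exists
      rw [tRight, if_pos hNH']
      refine ⟨le_of_lt h.1, fun hle => ?_⟩
      exact hconc.nonneg_iff_le_of_root ht hpos (hIoi ((tHat_nonneg hk).trans_lt h.1)) h.1 h.2
        htS hle
    · rw [tRight, if_neg hNH']
      -- Some `H_i = N_i` leaves only negative exponents, so `ψ` does not decrease to the right of
      -- `t̂` and stays positive there.
      refine ⟨tHat_le_one hk, fun hle => ⟨fun _ => ht1, fun _ => hpos.le.trans ?_⟩⟩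
      push Not at hNH'
      obtain ⟨i, hi⟩ := hNH'
      have hj : ∀ j ∈ diagRange k N H \ {0}, j < 0 := by
        intro j hj
        have h1 := (mem_diagRange.1 (Finset.mem_sdiff.1 hj).1).2 i
        have h2 : j ≠ 0 := by simpa using (Finset.mem_sdiff.1 hj).2
        omega
      rw [psi_eq, psi_eq]
      refine sub_le_sub_left (Finset.sum_le_sum fun j hjm => ?_) _
      refine mul_le_mul_of_nonneg_left ?_
        (psiCoeff_pos hN hNH hβ hk (Finset.mem_sdiff.1 hjm).1).le
      obtain ⟨n, rfl⟩ : ∃ n : ℕ, j = -(n : ℤ) := ⟨j.natAbs, by have := hj j hjm; omega⟩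
      have hn : n ≠ 0 := by have := hj _ hjm; omega
      by_cases hkN : ∀ i, k i < N i
      · rw [zpow_neg, zpow_neg, zpow_natCast, zpow_natCast]
        have := tHat_pos hkN
        gcongr
      · push Not at hkN
        obtain ⟨i, hi⟩ := hkN
        have := (mem_diagRange.1 (Finset.mem_sdiff.1 hjm).1).1 i
        omega
  rw [Set.mem_Icc]
  rcases lt_or_ge t (tHat k N) with h | h
  · rw [hL.2 h]; exact ⟨fun h => h.1, fun h' => ⟨h', h.le.trans hR.1⟩⟩
  · rw [hR.2 h]; exact ⟨fun h => h.2, fun h' => ⟨hL.1.trans h, h'⟩⟩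

omit hN hβ in
-- For `h = N + j 1` all exponents `h_i - N_i` equal `j`, so the product of powers is the `j`-th
-- power of one number; the other `λ_h` vanish.
theorem dualSum_diagAllocation (v : Fin m → ℝ) :
    dualSum (diagAllocation β N H) k N H v = psi β k N H (∏ i, (1 - v i)) := by
  classical
  set φ : ℤ → Fin m → ℕ := fun j i => ((N i : ℤ) + j).toNat with hφ
  set J := diagRange k N H \ {0} with hJ
  have hmem : ∀ j ∈ J, (∀ i, (φ j i : ℤ) = N i + j) := by
    intro j hj i
    have := (mem_diagRange.1 (Finset.mem_sdiff.1 hj).1).1 i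
    simp only [hφ]; omega
  have hinj : Set.InjOn φ J := by
    intro j hj j' hj' h
    have h1 := hmem j hj 0
    have h2 := hmem j' hj' 0
    have : φ j 0 = φ j' 0 := by rw [h]
    omega
  have hne : ∀ j ∈ J, φ j ≠ N := by
    intro j hj h
    have h1 := hmem j hj 0
    have h2 : j ≠ 0 := by simpa using (Finset.mem_sdiff.1 hj).2
    rw [h] at h1
    omega
  have hsub : J.image φ ⊆ (Finset.Icc k H).erase N := by
    intro h hh
    obtain ⟨j, hj, rfl⟩ := Finset.mem_image.1 hh
    have hj' := mem_diagRange.1 (Finset.mem_sdiff.1 hj).1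
    rw [Finset.mem_erase, Finset.mem_Icc]
    refine ⟨hne j hj, fun i => ?_, fun i => ?_⟩
    · have := hj'.1 i; have := hmem j hj i; show k i ≤ φ j i; omega
    · have := hj'.2 i; have := hmem j hj i; show φ j i ≤ H i; omega
  have hval : ∀ j ∈ J, diagAllocation β N H (φ j) = -β / ((diagRange 0 N H).card - 1) := by
    intro j hj
    rw [diagAllocation, if_neg (hne j hj), if_pos]
    refine ⟨j, ?_, hmem j hj⟩
    exact Finset.sdiff_subset_sdiff diagRange_subset le_rfl hj
  have h3 : (multiChoose N k : ℝ) ≠ 0 := by exact_mod_cast (multiChoose_pos hk).ne'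
  unfold dualSum
  rw [← Finset.add_sum_erase _ _ (Finset.mem_Icc.2 ⟨hk, hNH⟩),
    ← Finset.sum_subset hsub ?_, Finset.sum_image hinj, psi, sub_eq_add_neg, Finset.mul_sum,
    ← Finset.sum_neg_distrib]
  · congr 1
    · simp [diagAllocation, h3]
    · refine Finset.sum_congr rfl fun j hj => ?_
      rw [hval j hj, ← Finset.prod_zpow]
      have : ∀ i, (1 - v i) ^ ((φ j i : ℤ) - N i) = (1 - v i) ^ j := fun i => by
        rw [hmem j hj i]; congr 1; ring
      simp only [this]
      ring
  · intro h hh hnot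
    rw [Finset.mem_erase, Finset.mem_Icc] at hh
    have : diagAllocation β N H h = 0 := by
      rw [diagAllocation, if_neg hh.1, if_neg]
      rintro ⟨j, hj, hji⟩
      apply hnot
      rw [Finset.mem_image]
      refine ⟨j, ?_, funext fun i => ?_⟩
      · rw [hJ, Finset.mem_sdiff, mem_diagRange]
        refine ⟨⟨fun i => ?_, fun i => ?_⟩, (Finset.mem_sdiff.1 hj).2⟩
        · have := hji i; have : k i ≤ h i := hh.2.1 i; omega
        · have := hji i; have : h i ≤ H i := hh.2.2 i; omega
      · have := hji i; simp only [hφ]; omega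
    simp [this]

theorem mem_region_iff {v : Fin m → ℝ} (hv : ∀ i, v i ∈ Set.Icc (0 : ℝ) 1)
    (hpos : 0 < ∏ i, (1 - v i) ^ (N i - k i)) :
    v ∈ region β N H k ↔ 0 ≤ dualSum (diagAllocation β N H) k N H v := by
  rw [dualSum_diagAllocation hNH hk, ← mem_Icc_tLeft_tRight_iff hN hNH hβ hk]
  · exact ⟨fun h => h.2, fun h => ⟨hv, h⟩⟩
  · exact Finset.prod_nonneg fun i _ => by linarith [(hv i).2]
  · exact Finset.prod_le_one (fun i _ => by linarith [(hv i).2]) fun i _ => by linarith [(hv i).1]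
  -- All exponents `N_i - k_i` are positive here, so `hpos` excludes `v_i = 1`.
  · intro hkN
    refine Finset.prod_pos fun i _ => ?_
    rcases ((hv i).2).eq_or_lt with h | h
    · exfalso
      have : ∏ i, (1 - v i) ^ (N i - k i) = 0 := by
        refine Finset.prod_eq_zero (Finset.mem_univ i) ?_
        rw [h, sub_self]
        exact zero_pow (by have := hkN i; omega)
      linarith
    · linarith

end Psi

/-! ## Decisions based on a part of the scenarios -/

section Decision

variable {m : ℕ} {Δ 𝒵 : Type*} {h k : Fin m → ℕ}

/-- The positions in the `i`-th dataset that belong to a set of positions. -/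
def fiber (T : Finset ((i : Fin m) × Fin (h i))) (i : Fin m) : Finset (Fin (h i)) :=
  Finset.univ.filter fun j => ⟨i, j⟩ ∈ T

@[simp]
theorem mem_fiber {T : Finset ((i : Fin m) × Fin (h i))} {i : Fin m} {j : Fin (h i)} :
    j ∈ fiber T i ↔ ⟨i, j⟩ ∈ T := by
  simp [fiber]

theorem sigma_fiber (T : Finset ((i : Fin m) × Fin (h i))) :
    Finset.univ.sigma (fiber T) = T := by
  ext ⟨i, j⟩; simp

theorem fiber_sigma (t : ∀ i : Fin m, Finset (Fin (h i))) (i : Fin m) :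
    fiber (Finset.univ.sigma t) i = t i := by
  ext j; simp

/-- The vector of the numbers of positions in the datasets. -/
def size (T : Finset ((i : Fin m) × Fin (h i))) : Fin m → ℕ := fun i => (fiber T i).card

/-- The datasets restricted to a set of positions. -/
noncomputable def subData (ω : Sample Δ h) (T : Finset ((i : Fin m) × Fin (h i))) :
    Fin m → List Δ :=
  fun i => (fiber T i).toList.map fun j => ω ⟨i, j⟩

/-- The order chosen by `toList` is arbitrary; permutation invariance lets data be compared as
multisets. -/
theorem coe_subData (ω : Sample Δ h) (T : Finset ((i : Fin m) × Fin (h i))) (i : Fin m) :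
    (subData ω T i : Multiset Δ) = (fiber T i).val.map fun j => ω ⟨i, j⟩ := by
  rw [subData, ← Multiset.map_coe, Finset.coe_toList]

variable (M : (Fin m → List Δ) → 𝒵)

/-- The decision based on the scenarios in a set of positions. -/
noncomputable def decision (ω : Sample Δ h) (T : Finset ((i : Fin m) × Fin (h i))) : 𝒵 :=
  M (subData ω T)

/-- Every position in `T` carries a support scenario of the data restricted to `T`. -/
def IsIrreducible (ω : Sample Δ h) (T : Finset ((i : Fin m) × Fin (h i))) : Prop :=
  ∀ a ∈ T, decision M ω (T.erase a) ≠ decision M ω T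

open Classical in
/-- The positions of the support scenarios of the whole of the data. -/
noncomputable def support (ω : Sample Δ h) : Finset ((i : Fin m) × Fin (h i)) :=
  Finset.univ.filter fun a => decision M ω (Finset.univ.erase a) ≠ decision M ω Finset.univ

/-- `T` is irreducible and determines the decision. -/
def Determines (ω : Sample Δ h) (T : Finset ((i : Fin m) × Fin (h i))) : Prop :=
  IsIrreducible M ω T ∧ decision M ω Finset.univ = decision M ω T

variable {M} {A : Fin m → Δ → Set 𝒵} (hcons : IsConsistent A M)
include hcons

theorem IsConsistent.congr {D D' : Fin m → List Δ}
    (hD : ∀ i, (D i : Multiset Δ) = D' i) : M D = M D' :=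
  hcons.permutation_invariance D' D fun i => Multiset.coe_eq_coe.1 (hD i)

theorem IsConsistent.append_eq_iff (D E : Fin m → List Δ) :
    M (fun i => D i ++ E i) = M D ↔ ∀ i, ∀ δ ∈ E i, M D ∈ A i δ := by
  refine ⟨fun h => ?_, hcons.stability D E⟩
  by_contra hne
  push Not at hne
  exact hcons.responsiveness D E hne h

/-- Up to order, the data on `T'` are those on `T` followed by those on `T' \ T`; stability and
responsiveness give the two directions. Equality of decisions thus becomes one appropriateness
condition per added position. -/
theorem decision_eq_iff (ω : Sample Δ h) {T T' : Finset ((i : Fin m) × Fin (h i))} (hT : T ⊆ T') :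
    decision M ω T' = decision M ω T ↔ ∀ a ∈ T' \ T, decision M ω T ∈ A a.1 (ω a) := by
  have e : decision M ω T' = M fun i => subData ω T i ++ subData ω (T' \ T) i := by
    refine hcons.congr fun i => ?_
    rw [← Multiset.coe_add, coe_subData, coe_subData, coe_subData, ← Multiset.map_add]
    congr 1
    have hd : Disjoint (fiber T i) (fiber (T' \ T) i) := by
      rw [Finset.disjoint_left]; intro j; simp; tauto
    rw [← Finset.disjUnion_val _ _ hd, Finset.val_inj]
    ext j
    simp only [mem_fiber, Finset.disjUnion_eq_union, Finset.mem_union, Finset.mem_sdiff]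
    have := @hT ⟨i, j⟩
    tauto
  rw [e, decision, hcons.append_eq_iff]
  constructor
  · rintro h ⟨i, j⟩ ha
    refine h i _ ?_
    rw [← Multiset.mem_coe, coe_subData]
    exact Multiset.mem_map_of_mem _ (mem_fiber.2 ha)
  · intro h i δ hδ
    rw [← Multiset.mem_coe, coe_subData, Multiset.mem_map] at hδ
    obtain ⟨j, hj, rfl⟩ := hδ
    exact h ⟨i, j⟩ (mem_fiber.1 hj)

/-- The conditions imposed by `U \ T` are among those imposed by `T' \ T`. -/
theorem decision_eq_of_subset (ω : Sample Δ h) {T U T' : Finset ((i : Fin m) × Fin (h i))}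
    (h1 : T ⊆ U) (h2 : U ⊆ T') (hT : decision M ω T' = decision M ω T) :
    decision M ω U = decision M ω T := by
  rw [decision_eq_iff hcons ω (h1.trans h2)] at hT
  rw [decision_eq_iff hcons ω h1]
  exact fun a ha => hT a (Finset.sdiff_subset_sdiff h2 le_rfl ha)

/-- A position `a` outside `T` can be removed without effect, as `univ.erase a` lies between `T` and
`univ`. -/
theorem support_subset (ω : Sample Δ h) {T : Finset ((i : Fin m) × Fin (h i))}
    (hT : decision M ω Finset.univ = decision M ω T) : support M ω ⊆ T := by
  intro a ha
  by_contra haT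
  simp only [support, Finset.mem_filter, Finset.mem_univ, true_and] at ha
  refine ha ?_
  rw [hT]
  exact decision_eq_of_subset hcons ω (Finset.subset_erase.2 ⟨Finset.subset_univ _, haT⟩)
    (Finset.subset_univ _) hT

/-- When the support scenarios determine the decision, they form the only irreducible set of
positions that does. -/
theorem determines_iff (ω : Sample Δ h)
    (hω : decision M ω (support M ω) = decision M ω Finset.univ)
    (T : Finset ((i : Fin m) × Fin (h i))) : Determines M ω T ↔ T = support M ω := by
  constructor
  · rintro ⟨hirr, hT⟩
    refine subset_antisymm (fun a ha => ?_) (support_subset hcons ω hT)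
    by_contra has
    -- `T.erase a` still contains the support, so it gives the same decision, against
    -- irreducibility.
    refine hirr a ha ?_
    have hsub : support M ω ⊆ T.erase a :=
      Finset.subset_erase.2 ⟨support_subset hcons ω hT, has⟩
    rw [decision_eq_of_subset hcons ω hsub (Finset.subset_univ _) hω.symm, hω, hT]
  · rintro rfl
    refine ⟨fun a ha hne => ?_, hω.symm⟩
    -- Otherwise the support without `a` would determine the decision and so would have to contain
    -- the support.
    have h1 : decision M ω Finset.univ = decision M ω ((support M ω).erase a) := by
      rw [hne, hω]
    have := support_subset hcons ω h1 ha
    simp at this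

end Decision

/-! ### Transport along embeddings of positions; support scenarios as lists and as positions -/

section Embedding

variable {m : ℕ} {Δ 𝒵 : Type*} {h k : Fin m → ℕ}

/-- The embedding of positions that comes from embeddings for the separate datasets. -/
def posEmb (e : ∀ i, Fin (k i) ↪ Fin (h i)) :
    ((i : Fin m) × Fin (k i)) ↪ ((i : Fin m) × Fin (h i)) :=
  Function.Embedding.sigmaMap (Function.Embedding.refl _) e

@[simp]
theorem posEmb_apply (e : ∀ i, Fin (k i) ↪ Fin (h i)) (i : Fin m) (j : Fin (k i)) :
    posEmb e ⟨i, j⟩ = ⟨i, e i j⟩ := rfl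

theorem fiber_map (e : ∀ i, Fin (k i) ↪ Fin (h i)) (T : Finset ((i : Fin m) × Fin (k i)))
    (i : Fin m) : fiber (T.map (posEmb e)) i = (fiber T i).map (e i) := by
  ext j
  simp only [mem_fiber, Finset.mem_map, Sigma.exists]
  constructor
  · rintro ⟨i', j', hT, he⟩
    rw [posEmb_apply] at he
    obtain ⟨rfl, he⟩ := Sigma.mk.inj_iff.1 he
    exact ⟨j', hT, eq_of_heq he⟩
  · rintro ⟨j', hT, rfl⟩
    exact ⟨i, j', hT, rfl⟩

/-- Every set of positions is the image of an embedding. -/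
theorem exists_posEmb {T : Finset ((i : Fin m) × Fin (h i))} (hT : size T = k) :
    ∃ e : ∀ i, Fin (k i) ↪ Fin (h i), Finset.univ.map (posEmb e) = T := by
  have hT' : ∀ i, (fiber T i).card = k i := congrFun hT
  refine ⟨fun i => ((fiber T i).orderEmbOfFin (hT' i)).toEmbedding, ?_⟩
  ext ⟨i, j⟩
  rw [← mem_fiber, fiber_map, Finset.mem_map]
  have : j ∈ fiber T i ↔ j ∈ Set.range ((fiber T i).orderEmbOfFin (hT' i)) := by
    rw [Finset.range_orderEmbOfFin]; rfl
  rw [← mem_fiber (T := T), this]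
  simp only [fiber, Finset.mem_filter, Finset.mem_univ, true_and, Set.mem_range,
    RelEmbedding.coe_toEmbedding]

variable {M : (Fin m → List Δ) → 𝒵} {A : Fin m → Δ → Set 𝒵} (hcons : IsConsistent A M)
include hcons

theorem decision_map (e : ∀ i, Fin (k i) ↪ Fin (h i)) (ω : Sample Δ h)
    (T : Finset ((i : Fin m) × Fin (k i))) :
    decision M ω (T.map (posEmb e)) = decision M (ω ∘ posEmb e) T := by
  refine hcons.congr fun i => ?_
  rw [coe_subData, coe_subData, fiber_map, Finset.map_val, Multiset.map_map]
  rfl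

theorem decision_univ (ω : Sample Δ h) : decision M ω Finset.univ = M (datasets ω) := by
  refine hcons.congr fun i => ?_
  rw [coe_subData]
  have : fiber (Finset.univ : Finset ((i : Fin m) × Fin (h i))) i = Finset.univ := by ext; simp
  rw [this, Fin.univ_def]
  simp [datasets, List.ofFn_eq_map]

theorem decision_univ_eq_map_iff (e : ∀ i, Fin (k i) ↪ Fin (h i)) (ω : Sample Δ h) :
    decision M ω Finset.univ = decision M ω (Finset.univ.map (posEmb e)) ↔
      ∀ a ∉ Set.range (posEmb e), M (datasets (ω ∘ posEmb e : Sample Δ k)) ∈ A a.1 (ω a) := by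
  rw [decision_eq_iff hcons ω (Finset.subset_univ _), decision_map hcons, decision_univ hcons]
  simp

theorem isIrreducible_map (e : ∀ i, Fin (k i) ↪ Fin (h i)) (ω : Sample Δ h)
    (T : Finset ((i : Fin m) × Fin (k i))) :
    IsIrreducible M ω (T.map (posEmb e)) ↔ IsIrreducible M (ω ∘ posEmb e) T := by
  simp only [IsIrreducible, Finset.forall_mem_map, ← Finset.map_erase, decision_map hcons]

/-- Deleting a list entry and deleting a position leave the same multisets, as is seen by putting
the deleted scenario back. -/
theorem isSupport_iff (ω : Sample Δ h) (i : Fin m) (j : Fin (h i)) :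
    IsSupport M (datasets ω) i j ↔ (⟨i, j⟩ : (i : Fin m) × Fin (h i)) ∈ support M ω := by
  classical
  simp only [support, Finset.mem_filter, Finset.mem_univ, true_and, IsSupport,
    decision_univ hcons]
  rw [Ne, Ne]
  have : M (Function.update (datasets ω) i ((datasets ω i).eraseIdx j)) =
      decision M ω (Finset.univ.erase ⟨i, j⟩) := by
    refine hcons.congr fun i' => ?_
    rw [coe_subData]
    by_cases hi : i' = i
    · subst hi
      rw [Function.update_self]
      have hf : fiber ((Finset.univ : Finset ((i : Fin m) × Fin (h i))).erase ⟨i', j⟩) i' =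
          Finset.univ.erase j := by ext; simp
      have hlt : (j : ℕ) < (datasets ω i').length := by simp [datasets]
      have h1 : ω ⟨i', j⟩ ::ₘ (((datasets ω i').eraseIdx j : List Δ) : Multiset Δ) =
          datasets ω i' := by
        rw [Multiset.cons_coe, Multiset.coe_eq_coe]
        have := List.getElem_cons_eraseIdx_perm hlt
        simpa [datasets] using this
      have h2 : ω ⟨i', j⟩ ::ₘ ((Finset.univ.erase j).val.map fun j => ω ⟨i', j⟩) =
          datasets ω i' := by
        rw [← Multiset.map_cons (fun j => ω ⟨i', j⟩), ← Finset.insert_val_of_notMem (by simp),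
          Finset.insert_erase (Finset.mem_univ j), Fin.univ_def]
        simp [datasets, List.ofFn_eq_map]
      rw [hf, ← Multiset.cons_inj_right (ω ⟨i', j⟩), h1, h2]
    · rw [Function.update_of_ne hi]
      have hf : fiber ((Finset.univ : Finset ((i : Fin m) × Fin (h i))).erase ⟨i, j⟩) i' =
          Finset.univ := by
        ext; simp [hi]
      rw [hf, Fin.univ_def]
      simp [datasets, List.ofFn_eq_map]
  rw [this]

omit hcons in
-- Stated for a free list `L` and a free `n`, so that `subst` can identify `L.length` with `n`
-- inside the dependent types.
theorem map_get_filter_finRange {n : ℕ} (f : Fin n → Δ) (p : ℕ → Prop) [DecidablePred p]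
    (L : List Δ) (hL : L = List.ofFn f) :
    ((List.finRange L.length).filter fun j : Fin L.length => decide (p j.val)).map L.get =
      ((List.finRange n).filter fun j : Fin n => decide (p j.val)).map f := by
  have hlen : L.length = n := by simp [hL]
  subst hlen
  have : L.get = f := by
    have := hL.symm.trans (List.ofFn_get L).symm
    exact (List.ofFn_injective this).symm
  rw [this]

theorem coe_supportLists (ω : Sample Δ h) (i : Fin m) :
    (supportLists M (datasets ω) i : Multiset Δ) = subData ω (support M ω) i := by
  classical
  have := map_get_filter_finRange (fun j => ω ⟨i, j⟩) (fun j => IsSupport M (datasets ω) i j)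
    (datasets ω i) rfl
  rw [coe_subData, supportLists]
  convert congrArg (fun l : List Δ => (l : Multiset Δ)) this using 1
  have hf : fiber (support M ω) i = Finset.univ.filter fun j : Fin (h i) =>
      IsSupport M (datasets ω) i j := by
    ext j; simp [isSupport_iff hcons]
  rw [hf, Finset.filter_val, Fin.univ_def, ← Multiset.map_coe, ← Multiset.filter_coe]

theorem complexity_eq (ω : Sample Δ h) : complexity M (datasets ω) = size (support M ω) := by
  funext i
  have := congrArg Multiset.card (coe_supportLists hcons ω i)
  simpa [complexity, size, subData] using this

theorem decision_support (ω : Sample Δ h) :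
    M (supportLists M (datasets ω)) = decision M ω (support M ω) :=
  hcons.congr (coe_supportLists hcons ω)

omit hcons in
theorem size_le (T : Finset ((i : Fin m) × Fin (h i))) : size T ≤ h := fun i =>
  (Finset.card_le_univ (fiber T i)).trans_eq (Fintype.card_fin _)

omit hcons in
-- Via `fiber`, a set of positions is a family of subsets, one for each dataset.
theorem card_filter_size (h k : Fin m → ℕ) :
    (Finset.univ.filter fun T : Finset ((i : Fin m) × Fin (h i)) => size T = k).card =
      multiChoose h k := by
  classical
  have : (Fintype.piFinset fun i => Finset.powersetCard (k i) (Finset.univ : Finset (Fin (h i)))).card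
      = multiChoose h k := by
    simp [Fintype.card_piFinset, multiChoose]
  rw [← this]
  refine Finset.card_nbij' fiber (fun t => Finset.univ.sigma t) ?_ ?_ ?_ ?_
  · intro T hT
    simp only [Finset.coe_filter, Finset.mem_univ, true_and, Set.mem_ofPred_eq] at hT
    subst hT
    simp [Finset.mem_powersetCard, size]
  · intro t ht
    simp only [Finset.mem_coe, Fintype.mem_piFinset, Finset.mem_powersetCard_univ] at ht
    simp only [Finset.coe_filter, Finset.mem_univ, true_and, Set.mem_ofPred_eq]
    funext i
    rw [size, fiber_sigma, ht]
  · exact fun T _ => sigma_fiber T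
  · exact fun t _ => funext (fiber_sigma t)

end Embedding

/-! ## Measurability -/

section Measurability

variable {m : ℕ} {Δ 𝒵 : Type*} [MeasurableSpace Δ] {h k : Fin m → ℕ}
  {M : (Fin m → List Δ) → 𝒵} {A : Fin m → Δ → Set 𝒵}

theorem measurable_comp_posEmb (e : ∀ i, Fin (k i) ↪ Fin (h i)) :
    Measurable fun ω : Sample Δ h => (ω ∘ posEmb e : Sample Δ k) :=
  measurable_pi_lambda _ fun _ => measurable_pi_apply _

variable (hmeas : MeasurableAppropriateness A M) (hcons : IsConsistent A M)
include hmeas hcons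

theorem measurableSet_appropriate (T : Finset ((i : Fin m) × Fin (h i))) (i : Fin m) :
    MeasurableSet {p : Sample Δ h × Δ | decision M p.1 T ∈ A i p.2} := by
  obtain ⟨e, he⟩ := exists_posEmb (T := T) rfl
  have : {p : Sample Δ h × Δ | decision M p.1 T ∈ A i p.2} =
      (fun p => ((p.1 ∘ posEmb e : Sample Δ (size T)), p.2)) ⁻¹'
        {p | M (datasets p.1) ∈ A i p.2} := by
    ext p
    have : decision M p.1 T = M (datasets (p.1 ∘ posEmb e : Sample Δ (size T))) := by
      rw [← decision_univ hcons, ← decision_map hcons, he]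
    simp only [Set.mem_ofPred_eq, Set.mem_preimage, this]
  rw [this]
  exact ((measurable_comp_posEmb e).comp measurable_fst |>.prodMk measurable_snd) (hmeas _ i)

theorem measurableSet_appropriate_apply (T : Finset ((i : Fin m) × Fin (h i)))
    (a : (i : Fin m) × Fin (h i)) :
    MeasurableSet {ω : Sample Δ h | decision M ω T ∈ A a.1 (ω a)} :=
  (measurable_id.prodMk (measurable_pi_apply a))
    (measurableSet_appropriate hmeas hcons T a.1)

/-- `𝒵` carries no σ-algebra; for nested sets the event is a finite intersection of appropriateness
events. -/
theorem measurableSet_decision_eq {T T' : Finset ((i : Fin m) × Fin (h i))} (hT : T ⊆ T') :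
    MeasurableSet {ω : Sample Δ h | decision M ω T' = decision M ω T} := by
  have : {ω : Sample Δ h | decision M ω T' = decision M ω T} =
      ⋂ a ∈ T' \ T, {ω | decision M ω T ∈ A a.1 (ω a)} := by
    ext ω
    simp only [Set.mem_ofPred_eq, decision_eq_iff hcons _ hT, Set.mem_iInter]
  rw [this]
  exact Finset.measurableSet_biInter _ fun a _ =>
    measurableSet_appropriate_apply hmeas hcons T a

theorem measurableSet_isIrreducible (T : Finset ((i : Fin m) × Fin (h i))) :
    MeasurableSet {ω : Sample Δ h | IsIrreducible M ω T} := by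
  have : {ω : Sample Δ h | IsIrreducible M ω T} =
      ⋂ a ∈ T, {ω | decision M ω T = decision M ω (T.erase a)}ᶜ := by
    ext ω; simp [IsIrreducible, eq_comm]
  rw [this]
  exact Finset.measurableSet_biInter _ fun a _ =>
    (measurableSet_decision_eq hmeas hcons (Finset.erase_subset a T)).compl

theorem measurableSet_determines (T : Finset ((i : Fin m) × Fin (h i))) :
    MeasurableSet {ω : Sample Δ h | Determines M ω T} :=
  (measurableSet_isIrreducible hmeas hcons T).inter
    (measurableSet_decision_eq hmeas hcons (Finset.subset_univ T))

theorem measurableSet_support_eq (T : Finset ((i : Fin m) × Fin (h i))) :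
    MeasurableSet {ω : Sample Δ h | support M ω = T} := by
  classical
  have : {ω : Sample Δ h | support M ω = T} =
      ⋂ a, if a ∈ T then {ω | decision M ω Finset.univ = decision M ω (Finset.univ.erase a)}ᶜ
        else {ω | decision M ω Finset.univ = decision M ω (Finset.univ.erase a)} := by
    ext ω
    simp only [Finset.ext_iff, support, Finset.mem_filter, Finset.mem_univ, true_and,
      Set.mem_ofPred_eq, Set.mem_iInter]
    refine forall_congr' fun a => ?_
    by_cases ha : a ∈ T <;> simp [ha, eq_comm]
  rw [this]
  refine MeasurableSet.iInter fun a => ?_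
  have := measurableSet_decision_eq hmeas hcons (h := h) (Finset.subset_univ (Finset.univ.erase a))
  split_ifs
  exacts [this.compl, this]

theorem measurable_riskVec (P : Measure Δ) [IsProbabilityMeasure P]
    (T : Finset ((i : Fin m) × Fin (h i))) :
    Measurable fun ω : Sample Δ h => riskVec P A (decision M ω T) := by
  refine measurable_pi_lambda _ fun i => ?_
  have := measurable_measure_prodMk_left (ν := P) (measurableSet_appropriate hmeas hcons T i).compl
  exact this.ennreal_toReal

theorem measurable_riskVec_datasets (P : Measure Δ) [IsProbabilityMeasure P] :
    Measurable fun ω : Sample Δ h => riskVec P A (M (datasets ω)) := by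
  simpa only [decision_univ hcons] using measurable_riskVec hmeas hcons P (h := h) Finset.univ

end Measurability

/-! ## Integral formulas -/

section Probability

variable {m : ℕ} {Δ 𝒵 : Type*} [MeasurableSpace Δ] {P : Measure Δ} [IsProbabilityMeasure P]
  {h k : Fin m → ℕ} {M : (Fin m → List Δ) → 𝒵} {A : Fin m → Δ → Set 𝒵}

instance (N : Fin m → ℕ) : IsProbabilityMeasure (sampleLaw P N) := by
  unfold sampleLaw; infer_instance

theorem riskVec_mem_Icc (z : 𝒵) (i : Fin m) : riskVec P A z i ∈ Set.Icc (0 : ℝ) 1 :=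
  ⟨measureReal_nonneg, measureReal_le_one⟩

variable (P A M h) in
/-- The conditional probability, given the data, that `h - k` further scenarios are appropriate. -/
noncomputable def weight (x : Sample Δ k) : ℝ :=
  ∏ i, (1 - riskVec P A (M (datasets x)) i) ^ (h i - k i)

variable (P A M h k) in
/-- The probability that `h` scenarios have a given irreducible set of positions of size `k` that
determines a decision with risk in `S`. -/
noncomputable def irreducibleMass (S : Set (Fin m → ℝ)) : ℝ :=
  ∫ x in {x : Sample Δ k | IsIrreducible M x Finset.univ ∧ riskVec P A (M (datasets x)) ∈ S},
    weight P h M A x ∂sampleLaw P k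

theorem weight_nonneg (x : Sample Δ k) : 0 ≤ weight P h M A x :=
  Finset.prod_nonneg fun i _ => pow_nonneg (by linarith [(riskVec_mem_Icc (P := P) (A := A)
    (M (datasets x)) i).2]) _

theorem weight_le_one (x : Sample Δ k) : weight P h M A x ≤ 1 := by
  have hr := riskVec_mem_Icc (P := P) (A := A) (M (datasets x))
  exact Finset.prod_le_one (fun i _ => pow_nonneg (by linarith [(hr i).2]) _) fun i _ =>
    pow_le_one₀ (by linarith [(hr i).2]) (by linarith [(hr i).1])

/-- The measure preserving splitting of the data along an embedding of positions. -/
theorem exists_measurePreserving_split (e : ∀ i, Fin (k i) ↪ Fin (h i)) :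
    ∃ Ψ : Sample Δ k × ({a : (i : Fin m) × Fin (h i) // a ∉ Set.range (posEmb e)} → Δ) →
        Sample Δ h,
      MeasurePreserving Ψ ((sampleLaw P k).prod (Measure.pi fun _ => P)) (sampleLaw P h) ∧
      (∀ p, Ψ p ∘ posEmb e = p.1) ∧ ∀ p a, Ψ p a.1 = p.2 a := by
  classical
  let s : ((i : Fin m) × Fin (k i)) ⊕ {a : (i : Fin m) × Fin (h i) // a ∉ Set.range (posEmb e)} ≃
      ((i : Fin m) × Fin (h i)) :=
    (Equiv.sumCongr (Equiv.ofInjective _ (posEmb e).injective) (Equiv.refl _)).trans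
      (Equiv.Set.sumCompl (Set.range (posEmb e)))
  refine ⟨_, (measurePreserving_piCongrLeft (fun _ => P) s).comp
    (measurePreserving_sumPiEquivProdPi_symm fun _ => P), fun p => ?_, fun p a => ?_⟩
  · funext b
    exact Equiv.piCongrLeft_apply_apply (fun _ => Δ) s _ (Sum.inl b)
  · exact Equiv.piCongrLeft_apply_apply (fun _ => Δ) s _ (Sum.inr a)

/-- The embedding leaves out `h_i - k_i` positions of dataset `i`. -/
theorem prod_notMem_range (e : ∀ i, Fin (k i) ↪ Fin (h i)) (g : Fin m → ENNReal) :
    ∏ a : {a : (i : Fin m) × Fin (h i) // a ∉ Set.range (posEmb e)}, g a.1.1 =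
      ∏ i, g i ^ (h i - k i) := by
  classical
  have hs : ∀ a : (i : Fin m) × Fin (h i),
      a ∈ (Finset.univ.sigma fun i => (Finset.univ.map (e i))ᶜ) ↔ a ∉ Set.range (posEmb e) := by
    rintro ⟨i, j⟩
    have := congrArg (j ∈ ·) (fiber_map e Finset.univ i)
    simp only [mem_fiber, eq_iff_iff] at this
    have hu : fiber (Finset.univ : Finset ((i : Fin m) × Fin (k i))) i = Finset.univ := by
      ext; simp
    rw [hu] at this
    simp only [Finset.mem_univ, true_and, Finset.mem_sigma, Finset.mem_compl, ← this]
    simp only [Finset.mem_map, Finset.mem_univ, true_and, Set.mem_range]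
  rw [← Finset.prod_subtype _ hs fun a => g a.1, Finset.prod_sigma]
  simp [Finset.card_compl]

variable (hmeas : MeasurableAppropriateness A M) (hcons : IsConsistent A M)
include hmeas hcons

theorem measurable_weight : Measurable (weight P h M A : Sample Δ k → ℝ) := by
  unfold weight
  have := measurable_riskVec_datasets hmeas hcons P (h := k)
  exact Finset.measurable_prod _ fun i _ =>
    (measurable_const.sub ((measurable_pi_apply i).comp this)).pow_const _

theorem integrable_weight (μ : Measure (Sample Δ k)) [IsFiniteMeasure μ] :
    Integrable (weight P h M A : Sample Δ k → ℝ) μ :=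
  Integrable.of_bound (measurable_weight hmeas hcons).aestronglyMeasurable 1
    (Filter.Eventually.of_forall fun x => by
      rw [Real.norm_of_nonneg (weight_nonneg x)]; exact weight_le_one x)

/-- The probability that the data at some positions are in `C` and that the decision based on them
is appropriate for all the others. -/
theorem measureReal_extension (e : ∀ i, Fin (k i) ↪ Fin (h i)) {C : Set (Sample Δ k)}
    (hC : MeasurableSet C) :
    (sampleLaw P h).real {ω | ω ∘ posEmb e ∈ C ∧ ∀ a ∉ Set.range (posEmb e),
      M (datasets (ω ∘ posEmb e : Sample Δ k)) ∈ A a.1 (ω a)} =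
    ∫ x in C, weight P h M A x ∂sampleLaw P k := by
  obtain ⟨Ψ, hΨ, h1, h2⟩ := exists_measurePreserving_split (P := P) e
  set E := {ω : Sample Δ h | ω ∘ posEmb e ∈ C ∧ ∀ a ∉ Set.range (posEmb e),
      M (datasets (ω ∘ posEmb e : Sample Δ k)) ∈ A a.1 (ω a)} with hE
  have hEm : MeasurableSet E := by
    refine MeasurableSet.inter (measurable_comp_posEmb e hC) ?_
    have : {ω : Sample Δ h | ∀ a ∉ Set.range (posEmb e),
        M (datasets (ω ∘ posEmb e : Sample Δ k)) ∈ A a.1 (ω a)} =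
        ⋂ a, ⋂ (_ : a ∉ Set.range (posEmb e)),
          {ω | M (datasets (ω ∘ posEmb e : Sample Δ k)) ∈ A a.1 (ω a)} := by
      ext ω; simp
    change MeasurableSet {ω : Sample Δ h | ∀ a ∉ Set.range (posEmb e),
        M (datasets (ω ∘ posEmb e : Sample Δ k)) ∈ A a.1 (ω a)}
    rw [this]
    refine MeasurableSet.iInter fun a => MeasurableSet.iInter fun _ => ?_
    exact ((measurable_comp_posEmb e).prodMk (measurable_pi_apply a)) (hmeas k a.1)
  have hsec : ∀ x : Sample Δ k, Prod.mk x ⁻¹' (Ψ ⁻¹' E) =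
      {y | x ∈ C ∧ ∀ a, M (datasets x) ∈ A a.1.1 (y a)} := by
    intro x
    ext y
    simp only [hE, Set.mem_preimage, Set.mem_ofPred_eq, h1 (x, y)]
    refine and_congr Iff.rfl ⟨fun h a => ?_, fun h a ha => ?_⟩
    · rw [show y a = Ψ (x, y) a.1 from (h2 (x, y) a).symm]; exact h a.1 a.2
    · rw [show Ψ (x, y) a = y ⟨a, ha⟩ from h2 (x, y) ⟨a, ha⟩]; exact h ⟨a, ha⟩
  have hA : ∀ (x : Sample Δ k) (i : Fin m), P {δ | M (datasets x) ∈ A i δ} =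
      ENNReal.ofReal (1 - riskVec P A (M (datasets x)) i) := by
    intro x i
    have hm : MeasurableSet {δ | M (datasets x) ∈ A i δ} := measurable_prodMk_left (hmeas k i)
    have : {δ | M (datasets x) ∉ A i δ} = {δ | M (datasets x) ∈ A i δ}ᶜ := rfl
    rw [riskVec, this, probReal_compl_eq_one_sub hm, sub_sub_cancel, ofReal_measureReal]
  -- For fixed `x ∈ C` the section is a box in the remaining independent scenarios, whose measure is
  -- the weight.
  have hval : ∀ x : Sample Δ k, (Measure.pi fun _ => P) (Prod.mk x ⁻¹' (Ψ ⁻¹' E)) =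
      C.indicator (fun x => ENNReal.ofReal (weight P h M A x)) x := by
    intro x
    rw [hsec]
    by_cases hx : x ∈ C
    · rw [Set.indicator_of_mem hx]
      have : {y : {a : (i : Fin m) × Fin (h i) // a ∉ Set.range (posEmb e)} → Δ |
          x ∈ C ∧ ∀ a, M (datasets x) ∈ A a.1.1 (y a)} =
          Set.univ.pi fun a => {δ | M (datasets x) ∈ A a.1.1 δ} := by
        ext y; simp [hx]
      rw [this, Measure.pi_pi, prod_notMem_range e fun i => P {δ | M (datasets x) ∈ A i δ}]
      rw [weight, ENNReal.ofReal_prod_of_nonneg fun i _ => pow_nonneg (by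
        linarith [(riskVec_mem_Icc (P := P) (A := A) (M (datasets x)) i).2]) _]
      refine Finset.prod_congr rfl fun i _ => ?_
      rw [hA, ENNReal.ofReal_pow (by
        linarith [(riskVec_mem_Icc (P := P) (A := A) (M (datasets x)) i).2])]
    · simp [hx]
  rw [measureReal_def, ← hΨ.measure_preimage hEm.nullMeasurableSet,
    Measure.prod_apply (hΨ.measurable hEm)]
  simp only [hval]
  rw [lintegral_indicator hC, integral_eq_lintegral_of_nonneg_ae
    (Filter.Eventually.of_forall weight_nonneg)
    (measurable_weight hmeas hcons).aestronglyMeasurable]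

theorem measurableSet_irreducible_risk {S : Set (Fin m → ℝ)} (hS : MeasurableSet S) :
    MeasurableSet {x : Sample Δ k | IsIrreducible M x Finset.univ ∧
      riskVec P A (M (datasets x)) ∈ S} :=
  (measurableSet_isIrreducible hmeas hcons Finset.univ).inter
    (measurable_riskVec_datasets hmeas hcons P hS)

/-- Irreducibility involves only the data on `T`, and determining the decision means being
appropriate for the other positions; hence only the size of `T` matters. -/
theorem measureReal_determines {T : Finset ((i : Fin m) × Fin (h i))} (hT : size T = k)
    {S : Set (Fin m → ℝ)} (hS : MeasurableSet S) :
    (sampleLaw P h).real {ω | Determines M ω T ∧ riskVec P A (decision M ω T) ∈ S} =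
      irreducibleMass P h k M A S := by
  obtain ⟨e, rfl⟩ := exists_posEmb hT
  rw [irreducibleMass, ← measureReal_extension hmeas hcons e
    (measurableSet_irreducible_risk hmeas hcons hS)]
  congr 1
  ext ω
  rw [Set.mem_ofPred_eq, Determines, decision_univ_eq_map_iff hcons, isIrreducible_map hcons,
    decision_map hcons, decision_univ hcons]
  simp only [Set.mem_ofPred_eq]
  tauto

end Probability

/-! ## Sums of irreducible masses -/

section Mass

variable {m : ℕ} {Δ 𝒵 : Type*} [MeasurableSpace Δ] {P : Measure Δ} [IsProbabilityMeasure P]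
  {h k N : Fin m → ℕ} {M : (Fin m → List Δ) → 𝒵} {A : Fin m → Δ → Set 𝒵}

theorem sum_size_eq (h : Fin m → ℕ) (s : Finset (Fin m → ℕ)) (F : (Fin m → ℕ) → ℝ) :
    ∑ T : Finset ((i : Fin m) × Fin (h i)) with size T ∈ s, F (size T) =
      ∑ k ∈ s, multiChoose h k * F k := by
  classical
  rw [← Finset.sum_fiberwise_of_maps_to (s := Finset.univ.filter fun T => size T ∈ s) (t := s)
    (g := size) fun T hT => (Finset.mem_filter.1 hT).2]
  refine Finset.sum_congr rfl fun k hk => ?_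
  rw [Finset.sum_congr rfl (g := fun _ => F k) fun T hT => by rw [(Finset.mem_filter.1 hT).2],
    Finset.sum_const, nsmul_eq_mul, ← card_filter_size h k, Finset.filter_filter]
  congr 3
  ext T
  simp only [Finset.mem_filter, Finset.mem_univ, true_and, and_iff_right_iff_imp]
  rintro rfl
  exact hk

/-- The risk vectors for which the further `N - k` scenarios may all be appropriate. -/
def positiveSet (N k : Fin m → ℕ) : Set (Fin m → ℝ) := {v | 0 < ∏ i, (1 - v i) ^ (N i - k i)}

theorem measurableSet_positiveSet : MeasurableSet (positiveSet N k) :=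
  measurableSet_lt measurable_const (Finset.measurable_prod _ fun i _ =>
    (measurable_const.sub (measurable_pi_apply i)).pow_const _)

variable (hmeas : MeasurableAppropriateness A M) (hcons : IsConsistent A M)
  (hnondeg : NonDegenerate P M)
include hmeas hcons hnondeg

/-- Two different irreducible sets of positions almost surely do not both determine the decision,
unless the decision fails with probability one for a criterion without data. -/
theorem measure_determines_two_eq_zero {T T' : Finset ((i : Fin m) × Fin (h i))} (hT : T ≠ T') :
    sampleLaw P h {ω | (Determines M ω T ∧ Determines M ω T') ∧
      ∀ i, h i = 0 → riskVec P A (M (datasets ω)) i < 1} = 0 := by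
  set C := {ω : Sample Δ h | (Determines M ω T ∧ Determines M ω T') ∧
      ∀ i, h i = 0 → riskVec P A (M (datasets ω)) i < 1} with hCdef
  have hC : MeasurableSet C := by
    refine ((measurableSet_determines hmeas hcons T).inter
      (measurableSet_determines hmeas hcons T')).inter ?_
    have : {ω : Sample Δ h | ∀ i, h i = 0 → riskVec P A (M (datasets ω)) i < 1} =
        ⋂ i, ⋂ (_ : h i = 0), {ω | riskVec P A (M (datasets ω)) i < 1} := by
      ext ω; simp only [Set.mem_ofPred_eq, Set.mem_iInter]
    change MeasurableSet {ω : Sample Δ h | ∀ i, h i = 0 → riskVec P A (M (datasets ω)) i < 1}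
    rw [this]
    exact MeasurableSet.iInter fun i => MeasurableSet.iInter fun _ => measurableSet_lt
      ((measurable_pi_apply i).comp (measurable_riskVec_datasets hmeas hcons P)) measurable_const
  -- Non-degeneracy speaks only of positive sizes, so each empty dataset receives one extra
  -- scenario.
  set h' : Fin m → ℕ := fun i => max (h i) 1 with hh'
  let e : ∀ i, Fin (h i) ↪ Fin (h' i) := fun i => Fin.castLEEmb (le_max_left _ _)
  have hnull : (sampleLaw P h').real {ω | ω ∘ posEmb e ∈ C ∧ ∀ a ∉ Set.range (posEmb e),
      M (datasets (ω ∘ posEmb e : Sample Δ h)) ∈ A a.1 (ω a)} = 0 := by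
    rw [measureReal_eq_zero_iff]
    refine measure_mono_null ?_ (hnondeg h' fun i => by simp [hh'])
    rintro ω ⟨⟨⟨h1, h2⟩, -⟩, hgood⟩ hω
    rw [← decision_univ_eq_map_iff hcons, decision_map hcons] at hgood
    change M (supportLists M (datasets ω)) = M (datasets ω) at hω
    rw [decision_support hcons, ← decision_univ hcons] at hω
    -- If the extra scenarios are appropriate, a determining set remains determining for the larger
    -- data, where it must be the support.
    have lift : ∀ U, Determines M (ω ∘ posEmb e : Sample Δ h) U →
        U.map (posEmb e) = support M ω := by
      rintro U ⟨hU, hU'⟩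
      rw [← determines_iff hcons ω hω, Determines, isIrreducible_map hcons, decision_map hcons,
        hgood]
      exact ⟨hU, hU'⟩
    exact hT (Finset.map_injective _ ((lift T h1).trans (lift T' h2).symm))
  rw [measureReal_extension hmeas hcons e hC, integral_eq_zero_iff_of_nonneg weight_nonneg
    (integrable_weight hmeas hcons _), Filter.EventuallyEq, ae_restrict_iff' hC] at hnull
  refine measure_mono_null ?_ hnull
  intro x hx hx'
  have := hx' hx
  refine absurd this (ne_of_gt ?_)
  -- The weight integrates to 0 over `C`, yet it is positive on `C`: only criteria with `h_i = 0`
  -- contribute, and there the risk is below 1. So `C` is null.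
  refine Finset.prod_pos fun i _ => ?_
  rcases Nat.eq_zero_or_pos (h i) with h0 | h0
  · exact pow_pos (by linarith [hx.2 i h0]) _
  · have : h' i - h i = 0 := by simp only [hh']; omega
    rw [this, pow_zero]; exact one_pos

/-- The masses are probabilities of events that are almost surely disjoint for different `T`. -/
theorem sum_irreducibleMass_le_one (hN : ∀ i, 0 < N i) (h : Fin m → ℕ) :
    ∑ k ∈ Finset.Icc 0 N, multiChoose h k * irreducibleMass P h k M A (positiveSet N k) ≤ 1 := by
  rw [← sum_size_eq h _ fun k => irreducibleMass P h k M A (positiveSet N k)]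
  have hm : ∀ T : Finset ((i : Fin m) × Fin (h i)), MeasurableSet {ω : Sample Δ h |
      Determines M ω T ∧ riskVec P A (decision M ω T) ∈ positiveSet N (size T)} := fun T =>
    (measurableSet_determines hmeas hcons T).inter
      (measurable_riskVec hmeas hcons P T measurableSet_positiveSet)
  rw [Finset.sum_congr rfl fun T _ =>
    (measureReal_determines hmeas hcons (T := T) rfl measurableSet_positiveSet).symm,
    ← measureReal_biUnion_finset₀ (fun T hT T' hT' hne => ?_) fun T _ => (hm T).nullMeasurableSet]
  · exact measureReal_le_one
  · refine measure_mono_null ?_ (measure_determines_two_eq_zero hmeas hcons hnondeg hne)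
    rintro ω ⟨⟨h1, h2⟩, ⟨h1', -⟩⟩
    refine ⟨⟨h1, h1'⟩, fun i hi => ?_⟩
    rw [← h1.2, decision_univ hcons] at h2
    refine lt_of_le_of_ne (riskVec_mem_Icc _ i).2 fun hone => ?_
    rw [positiveSet, Set.mem_ofPred_eq] at h2
    refine (ne_of_gt h2) (Finset.prod_eq_zero (Finset.mem_univ i) ?_)
    rw [hone, sub_self]
    -- `h i = 0` forces `size T i = 0`, so the exponent is `N i > 0`.
    refine zero_pow ?_
    have h3 : size T i ≤ h i := size_le T i
    have := hN i
    omega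

theorem irreducibleMass_size_eq (hN : ∀ i, 0 < N i) (T : Finset ((i : Fin m) × Fin (N i)))
    {S : Set (Fin m → ℝ)} (hS : MeasurableSet S) :
    (sampleLaw P N).real {ω | support M ω = T ∧ riskVec P A (M (datasets ω)) ∈ S} =
      irreducibleMass P N (size T) M A S := by
  rw [← measureReal_determines hmeas hcons rfl hS]
  refine measureReal_congr ?_
  filter_upwards [hnondeg N hN] with ω hω
  rw [decision_support hcons, ← decision_univ hcons] at hω
  refine propext ?_
  change (_ ∧ _) ↔ (_ ∧ _)
  rw [determines_iff hcons ω hω, eq_comm]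
  refine and_congr_right ?_
  rintro rfl
  rw [hω, decision_univ hcons]

omit [IsProbabilityMeasure P] hmeas hnondeg in
theorem event_eq_iUnion (R : (Fin m → ℕ) → Set (Fin m → ℝ)) :
    {ω : Sample Δ N | riskVec P A (M (datasets ω)) ∈ R (complexity M (datasets ω))} =
      ⋃ T, {ω | support M ω = T ∧ riskVec P A (M (datasets ω)) ∈ R (size T)} := by
  ext ω
  simp [complexity_eq hcons]

omit hnondeg in
theorem measurableSet_event {R : (Fin m → ℕ) → Set (Fin m → ℝ)} (hR : ∀ k, MeasurableSet (R k)) :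
    MeasurableSet {ω : Sample Δ N |
      riskVec P A (M (datasets ω)) ∈ R (complexity M (datasets ω))} := by
  rw [event_eq_iUnion hcons]
  exact MeasurableSet.iUnion fun T => (measurableSet_support_eq hmeas hcons T).inter
    (measurable_riskVec_datasets hmeas hcons P (hR _))

/-- The distribution of complexity and risk in terms of the irreducible masses. -/
theorem measureReal_event (hN : ∀ i, 0 < N i) {R : (Fin m → ℕ) → Set (Fin m → ℝ)}
    (hR : ∀ k, MeasurableSet (R k)) :
    (sampleLaw P N).real {ω : Sample Δ N |
      riskVec P A (M (datasets ω)) ∈ R (complexity M (datasets ω))} =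
    ∑ k ∈ Finset.Icc 0 N, multiChoose N k * irreducibleMass P N k M A (R k) := by
  classical
  rw [event_eq_iUnion hcons, measureReal_iUnion_fintype, ← sum_size_eq N _
    fun k => irreducibleMass P N k M A (R k)]
  · rw [Finset.filter_true_of_mem fun T _ =>
      Finset.mem_Icc.2 ⟨show 0 ≤ size T from fun i => Nat.zero_le _, size_le T⟩]
    exact Finset.sum_congr rfl fun T _ => irreducibleMass_size_eq hmeas hcons hnondeg hN T (hR _)
  · intro T T' hne
    rw [Function.onFun, Set.disjoint_left]
    rintro ω ⟨h1, -⟩ ⟨h2, -⟩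
    exact hne (h1.symm.trans h2)
  · exact fun T => (measurableSet_support_eq hmeas hcons T).inter
      (measurable_riskVec_datasets hmeas hcons P (hR _))

omit hnondeg in
-- For `h = N` the integrand is the very product whose positivity defines `positiveSet`, so nothing
-- is lost.
theorem irreducibleMass_positiveSet :
    irreducibleMass P N k M A (positiveSet N k) = irreducibleMass P N k M A Set.univ := by
  refine (setIntegral_eq_of_subset_of_forall_sdiff_eq_zero
    (measurableSet_irreducible_risk hmeas hcons MeasurableSet.univ)
    (fun x hx => ⟨hx.1, trivial⟩) ?_).symm
  rintro x ⟨hx, hx'⟩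
  by_contra hne
  exact hx' ⟨hx.1, lt_of_le_of_ne (weight_nonneg x) (Ne.symm hne)⟩

theorem sum_irreducibleMass_eq_one (hN : ∀ i, 0 < N i) :
    ∑ k ∈ Finset.Icc 0 N, multiChoose N k * irreducibleMass P N k M A (positiveSet N k) = 1 := by
  simp only [irreducibleMass_positiveSet hmeas hcons]
  rw [← measureReal_event hmeas hcons hnondeg hN (R := fun _ => Set.univ)
    fun _ => MeasurableSet.univ]
  simp

end Mass

/-! ## The dual bound -/

section Dual

variable {m : ℕ} {Δ 𝒵 : Type*} [MeasurableSpace Δ] {P : Measure Δ} [IsProbabilityMeasure P]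
  {h k N H : Fin m → ℕ} {M : (Fin m → List Δ) → 𝒵} {A : Fin m → Δ → Set 𝒵}
  {lam : (Fin m → ℕ) → ℝ}

omit [IsProbabilityMeasure P] in
theorem multiChoose_mul_weight_mul_dualSum (hk : k ≤ N) {x : Sample Δ k}
    (h0 : weight P N M A x ≠ 0) :
    multiChoose N k * weight P N M A x * dualSum lam k N H (riskVec P A (M (datasets x))) =
      ∑ h ∈ Finset.Icc k H, lam h * multiChoose h k * weight P h M A x := by
  have h3 : (multiChoose N k : ℝ) ≠ 0 := by
    exact_mod_cast (multiChoose_pos hk).ne'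
  rw [dualSum, Finset.mul_sum]
  refine Finset.sum_congr rfl fun h hh => ?_
  have hkh := (Finset.mem_Icc.1 hh).1
  have key : weight P N M A x * ∏ i, (1 - riskVec P A (M (datasets x)) i) ^ ((h i : ℤ) - N i) =
      weight P h M A x := by
    rw [weight, weight, ← Finset.prod_mul_distrib]
    refine Finset.prod_congr rfl fun i _ => ?_
    have hki : k i ≤ N i := hk i
    have hkhi : k i ≤ h i := hkh i
    -- At `v_i = 1` exponents of `zpow` cannot simply be added; there a nonzero weight forces `k_i =
    -- N_i`, and both sides carry the same power.
    by_cases hz : 1 - riskVec P A (M (datasets x)) i = 0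
    · have : N i - k i = 0 := by
        by_contra hne
        exact h0 (Finset.prod_eq_zero (Finset.mem_univ i) (by rw [hz, zero_pow hne]))
      rw [this, pow_zero, one_mul, ← zpow_natCast]
      congr 1; omega
    · rw [← zpow_natCast, ← zpow_natCast, ← zpow_add₀ hz]
      congr 1; omega
  rw [← key]
  field_simp

variable (hmeas : MeasurableAppropriateness A M) (hcons : IsConsistent A M)
include hmeas hcons

/-- All masses are integrals over the same set of samples, so the weighted sum has integrand
`multiChoose N k * weight * dualSum`; it is compared pointwise using `hle` on `R` and `hR` off it.
-/
theorem sum_mul_irreducibleMass_le (hk : k ≤ N) {R : Set (Fin m → ℝ)} (hRm : MeasurableSet R)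
    (hle : ∀ v : Fin m → ℝ, (∀ i, v i ∈ Set.Icc (0 : ℝ) 1) → dualSum lam k N H v ≤ 1)
    (hR : ∀ v : Fin m → ℝ, (∀ i, v i ∈ Set.Icc (0 : ℝ) 1) → v ∈ positiveSet N k → v ∉ R →
      dualSum lam k N H v ≤ 0) :
    ∑ h ∈ Finset.Icc k H, lam h * (multiChoose h k * irreducibleMass P h k M A (positiveSet N k)) ≤
      multiChoose N k * irreducibleMass P N k M A R := by
  have hpos := measurableSet_irreducible_risk (k := k) (P := P) hmeas hcons
    (measurableSet_positiveSet (N := N) (k := k))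
  have hRset := measurableSet_irreducible_risk (k := k) (P := P) hmeas hcons hRm
  have e1 : ∑ h ∈ Finset.Icc k H,
      lam h * (multiChoose h k * irreducibleMass P h k M A (positiveSet N k)) =
      ∫ x in {x : Sample Δ k | IsIrreducible M x Finset.univ ∧
        riskVec P A (M (datasets x)) ∈ positiveSet N k},
        ∑ h ∈ Finset.Icc k H, lam h * multiChoose h k * weight P h M A x ∂sampleLaw P k := by
    rw [integral_finsetSum _ fun h _ => (integrable_weight hmeas hcons _).const_mul _]
    refine Finset.sum_congr rfl fun h _ => ?_
    rw [integral_const_mul, irreducibleMass, mul_assoc]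
  rw [e1, irreducibleMass, ← integral_const_mul, ← integral_indicator hpos,
    ← integral_indicator hRset]
  refine integral_mono ?_ ?_ fun x => ?_
  · exact (integrable_finsetSum _ fun h _ =>
      (integrable_weight hmeas hcons _).const_mul _).indicator hpos
  · exact ((integrable_weight hmeas hcons _).const_mul _).indicator hRset
  have hv : ∀ i, riskVec P A (M (datasets x)) i ∈ Set.Icc (0 : ℝ) 1 := riskVec_mem_Icc _
  have hC : 0 ≤ multiChoose N k * weight P N M A x :=
    mul_nonneg (Nat.cast_nonneg _) (weight_nonneg x)
  by_cases hx : x ∈ {x : Sample Δ k | IsIrreducible M x Finset.univ ∧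
        riskVec P A (M (datasets x)) ∈ positiveSet N k}
  · rw [Set.indicator_of_mem hx]
    have hw : weight P N M A x ≠ 0 := ne_of_gt hx.2
    rw [← multiChoose_mul_weight_mul_dualSum hk hw]
    by_cases hxR : riskVec P A (M (datasets x)) ∈ R
    · rw [Set.indicator_of_mem (show x ∈ {x : Sample Δ k | IsIrreducible M x Finset.univ ∧
        riskVec P A (M (datasets x)) ∈ R} from ⟨hx.1, hxR⟩)]
      exact mul_le_of_le_one_right hC (hle _ hv)
    · rw [Set.indicator_of_notMem fun h => hxR h.2]
      exact mul_nonpos_of_nonneg_of_nonpos hC (hR _ hv hx.2 hxR)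
  · rw [Set.indicator_of_notMem hx]
    exact Set.indicator_nonneg (fun x _ =>
      mul_nonneg (Nat.cast_nonneg _) (weight_nonneg x)) x

variable (hnondeg : NonDegenerate P M)
include hnondeg

/-- A feasible dual allocation bounds the confidence of the regions that it generates. -/
theorem sum_le_measureReal_event (hN : ∀ i, 0 < N i) (hNH : N ≤ H) (hlam : ∀ h ≠ N, lam h ≤ 0)
    {R : (Fin m → ℕ) → Set (Fin m → ℝ)} (hRm : ∀ k, MeasurableSet (R k))
    (hle : ∀ k ≤ N, ∀ v : Fin m → ℝ, (∀ i, v i ∈ Set.Icc (0 : ℝ) 1) → dualSum lam k N H v ≤ 1)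
    (hR : ∀ k ≤ N, ∀ v : Fin m → ℝ, (∀ i, v i ∈ Set.Icc (0 : ℝ) 1) → v ∈ positiveSet N k →
      v ∉ R k → dualSum lam k N H v ≤ 0) :
    ∑ h ∈ Finset.Icc 0 H, lam h ≤ (sampleLaw P N).real {ω : Sample Δ N |
      riskVec P A (M (datasets ω)) ∈ R (complexity M (datasets ω))} := by
  rw [measureReal_event hmeas hcons hnondeg hN hRm]
  have h0N : N ∈ Finset.Icc 0 H := Finset.mem_Icc.2 ⟨fun i => Nat.zero_le _, hNH⟩
  calc ∑ h ∈ Finset.Icc 0 H, lam h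
      ≤ ∑ h ∈ Finset.Icc 0 H, lam h * ∑ k ∈ Finset.Icc 0 N,
          multiChoose h k * irreducibleMass P h k M A (positiveSet N k) := by
        refine Finset.sum_le_sum fun h _ => ?_
        -- Equality at `N` permits any sign of `λ_N`; elsewhere `λ_h ≤ 0` turns the bound by 1
        -- around.
        by_cases hh : h = N
        · rw [hh, sum_irreducibleMass_eq_one hmeas hcons hnondeg hN, mul_one]
        · have := sum_irreducibleMass_le_one hmeas hcons hnondeg hN h
          nlinarith [hlam h hh]
    _ = ∑ k ∈ Finset.Icc 0 N, ∑ h ∈ Finset.Icc 0 H,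
          lam h * (multiChoose h k * irreducibleMass P h k M A (positiveSet N k)) := by
        simp only [Finset.mul_sum]
        exact Finset.sum_comm
    _ = ∑ k ∈ Finset.Icc 0 N, ∑ h ∈ Finset.Icc k H,
          lam h * (multiChoose h k * irreducibleMass P h k M A (positiveSet N k)) := by
        refine Finset.sum_congr rfl fun k _ => (Finset.sum_subset ?_ fun h hh hnot => ?_).symm
        · exact Finset.Icc_subset_Icc_left fun i => Nat.zero_le _
        · have hkh : ¬ k ≤ h := fun hkh =>
            hnot (Finset.mem_Icc.2 ⟨hkh, (Finset.mem_Icc.1 hh).2⟩)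
          have : multiChoose h k = 0 := by
            rw [Pi.le_def] at hkh
            push Not at hkh
            obtain ⟨i, hi⟩ := hkh
            exact Finset.prod_eq_zero (Finset.mem_univ i) (Nat.choose_eq_zero_of_lt hi)
          simp [this]
    _ ≤ ∑ k ∈ Finset.Icc 0 N, multiChoose N k * irreducibleMass P N k M A (R k) :=
        Finset.sum_le_sum fun k hk =>
          have hk := (Finset.mem_Icc.1 hk).2
          sum_mul_irreducibleMass_le hmeas hcons hk (hRm k) (hle k hk) (hR k hk)

end Dual

/-! ### Feasibility and value of the diagonal allocation -/

section Diagonal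

variable {m : ℕ} [NeZero m] {k N H : Fin m → ℕ} {β : ℝ}

theorem measurableSet_region : MeasurableSet (region β N H k) := by
  have h1 : MeasurableSet {v : Fin m → ℝ | ∀ i, v i ∈ Set.Icc (0 : ℝ) 1} := by
    have : {v : Fin m → ℝ | ∀ i, v i ∈ Set.Icc (0 : ℝ) 1} =
        Set.univ.pi fun _ => Set.Icc (0 : ℝ) 1 := by
      ext; simp only [Set.mem_ofPred_eq, Set.mem_univ_pi]
    rw [this]
    exact MeasurableSet.univ_pi fun _ => measurableSet_Icc
  have h2 : Measurable fun v : Fin m → ℝ => ∏ i, (1 - v i) :=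
    Finset.measurable_prod _ fun i _ => measurable_const.sub (measurable_pi_apply i)
  exact h1.inter (h2 measurableSet_Icc)

theorem psi_le_one (hN : ∀ i, 0 < N i) (hNH : N ≤ H) (hβ : β ∈ Set.Ioo (0 : ℝ) 1) (hk : k ≤ N)
    {t : ℝ} (ht : 0 ≤ t) : psi β k N H t ≤ 1 := by
  rw [psi_eq]
  have : 0 ≤ ∑ j ∈ diagRange k N H \ {0}, psiCoeff β k N H j * t ^ j :=
    Finset.sum_nonneg fun j hj => mul_nonneg
      (psiCoeff_pos hN hNH hβ hk (Finset.mem_sdiff.1 hj).1).le (zpow_nonneg ht _)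
  linarith

/-- At `k = 0` and `v = 0` all binomials and powers are 1, so the dual sum is the plain sum of the
`λ_h`. -/
theorem sum_diagAllocation (hN : ∀ i, 0 < N i) (hNH : N ≤ H) :
    ∑ h ∈ Finset.Icc 0 H, diagAllocation β N H h = 1 - β := by
  have h := dualSum_diagAllocation (β := β) (k := 0) hNH (fun i => Nat.zero_le _) (fun _ => 0)
  have hc : ((diagRange 0 N H).card : ℝ) - 1 ≠ 0 := by
    have := one_lt_card_diagRange hN hNH; linarith
  have h0 := zero_mem_diagRange (k := 0) (fun i => Nat.zero_le _) hNH
  simp only [dualSum, psi, multiChoose, Pi.zero_apply, Nat.choose_zero_right,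
    Finset.prod_const_one, Nat.cast_one, div_one, mul_one, sub_zero, one_zpow, Finset.sum_const,
    nsmul_eq_mul] at h
  rw [h, Finset.sdiff_singleton_eq_erase, Finset.cast_card_erase_of_mem h0]
  field_simp

end Diagonal

end MultiScenario

theorem proposition1 {Δ 𝒵 : Type*} [MeasurableSpace Δ] (P : Measure Δ) [IsProbabilityMeasure P]
    (m : ℕ) [NeZero m]
    (A : Fin m → Δ → Set 𝒵) (M : (Fin m → List Δ) → 𝒵)
    (hmeas : MeasurableAppropriateness A M)
    (hcons : IsConsistent A M) (hnondeg : NonDegenerate P M)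
    (N H : Fin m → ℕ) (hN : ∀ i, 0 < N i) (hNH : N ≤ H)
    (β : ℝ) (hβ : β ∈ Set.Ioo (0 : ℝ) 1) :
    -- the two zeros that define the region exist and are unique
    (∀ k : Fin m → ℕ, k ≤ N →
      ((∀ i, k i < N i) → ∃! t, t ∈ Set.Ioo 0 (tHat k N) ∧ psi β k N H t = 0) ∧
      ((∀ i, N i < H i) → ∃! t, t ∈ Set.Ioi (tHat k N) ∧ psi β k N H t = 0)) ∧
    -- the region is the one that the diagonal allocation generates
    (∀ k : Fin m → ℕ, k ≤ N → ∀ v : Fin m → ℝ, (∀ i, v i ∈ Set.Icc (0 : ℝ) 1) →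
      0 < ∏ i, (1 - v i) ^ (N i - k i) →
      (v ∈ region β N H k ↔ 0 ≤ dualSum (diagAllocation β N H) k N H v)) ∧
    -- the risk vector lies in the region with confidence `1 - β`
    MeasurableSet {ω : Sample Δ N |
      riskVec P A (M (datasets ω)) ∈ region β N H (complexity M (datasets ω))} ∧
    ENNReal.ofReal (1 - β) ≤ sampleLaw P N {ω : Sample Δ N |
      riskVec P A (M (datasets ω)) ∈ region β N H (complexity M (datasets ω))} := by
  refine ⟨fun k hk => ⟨existsUnique_left hN hNH hβ hk, existsUnique_right hN hNH hβ hk⟩,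
    fun k hk v hv hpos => mem_region_iff hN hNH hβ hk hv hpos,
    measurableSet_event hmeas hcons fun k => measurableSet_region, ?_⟩
  rw [ENNReal.ofReal_le_iff_le_toReal (measure_ne_top _ _), ← measureReal_def,
    ← sum_diagAllocation hN hNH]
  refine sum_le_measureReal_event hmeas hcons hnondeg hN hNH (fun h hh => ?_)
    (fun k => measurableSet_region) (fun k hk v hv => ?_) fun k hk v hv hpos hvR => ?_
  · rw [diagAllocation, if_neg hh]
    split_ifs
    · have := one_lt_card_diagRange hN hNH
      exact div_nonpos_of_nonpos_of_nonneg (by linarith [hβ.1]) (by linarith)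
    · exact le_rfl
  · rw [dualSum_diagAllocation hNH hk]
    exact psi_le_one hN hNH hβ hk (Finset.prod_nonneg fun i _ => by linarith [(hv i).2])
  · rw [mem_region_iff hN hNH hβ hk hv hpos] at hvR
    exact (not_le.1 hvR).le
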